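/- Regular extended network. Fix integers $B,N\ge 1$ and real constants $\alpha>1$, $\beta>0$, $0<r_0<R$, $P_{con}>0$, $p>0$. Transmitters $1,\dots,B$ sit at distinct points of a regular hexagonal (triangular-lattice) grid in $\mathbb R^2$ whose neighbouring points are at distance $2R$; the cell of a transmitter is the regular hexagon of inradius $R$ around it (its Voronoi cell in the grid). Each cell contains $\rho=K/B\in\mathbb N$ users placed independently and uniformly in it. Between transmitter $i$ and user $k$ on resource block $n$ the SNR is $\gamma_{i,k,n}=\beta^2R_{i,k}^{-2\alpha}|\nu_{i,k,n}|^2$, where $R_{i,k}$ is the maximum of $r_0$ and their distance, and the $\nu_{i,k,n}$ are i.i.d. $\mathcal{CN}(0,1)$ (Rayleigh fading), independent of the user positions. Let $\mathcal P$ be the set of power allocations $(p_{i,n})$ with $p_{i,n}\ge 0$ and $\sum_n p_{i,n}\le P_{con}$ for all $i$, and let $\mathcal U$ be the set of user allocations $(u_{i,n})$ in which $u_{i,n}$ is a user in the cell of transmitter $i$. Put $$\mathcal C^*_{\mathsf{LB}}=\max_{(p_{i,n})\in\mathcal P}\mathbb E\Big\{\max_{(u_{i,n})\in\mathcal U}\sum_{i=1}^B\sum_{n=1}^N\log\Big(1+\frac{\gamma_{i,u_{i,n},n}\,p_{i,n}}{1+\sum_{j\ne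 i}\gamma_{j,u_{i,n},n}\,p_{j,n}}\Big)\Big\}.$$ For $c,h>0$ let $$\mathsf{OP}(c,h)=\max_{(p_{i,n})\in\mathcal P}\sum_{i=1}^B\sum_{n=1}^N\log(1+p_{i,n}x_{i,n}),$$ where the $x_{i,n}\ge 0$ are subject to $$\frac{r_0^2h}{p^2}=e^{x_{i,n}/(\beta^2r_0^{-2\alpha})}\prod_{j\ne i}\Big(1+\frac{p_{j,n}x_{i,n}}{c^{2\alpha}r_0^{-2\alpha}}\Big)\quad\text{for all }i,n,$$ and let $\bar l(c,h)$ be the positive solution $l$ of $$\frac{r_0^2h}{p^2}=e^{l/(\beta^2r_0^{-2\alpha})}\Big(1+\frac{l\,P_{con}}{c^{2\alpha}r_0^{-2\alpha}}\Big)^{B-1}.$$ Here $p$ is an arbitrary fixed normalising radius (for example, the radius of the network, or $p=R$, the effective radius of a cell). Let $u$ be the Euler–Mascheroni constant. Then for all sufficiently large $\rho$ (with all the constants above and the transmitter positions fixed), the expectations are finite, the maxima are attained, $\bar l(R\sqrt3/2,\rho)$ exists and is unique, and $$\Big(1-\frac1{\log\rho}\Big)\mathsf{OP}\Big(r_0,\frac{\rho}{\log\log\rho}\Big)\le\mathcal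 C^*_{\mathsf{LB}}\le\Big(1+\frac{\beta^2r_0^{-2\alpha}u}{\bar l(R\sqrt3/2,\rho)}\Big)\mathsf{OP}\Big(\frac{R\sqrt3}{2},\rho\Big),$$ $$0.63\,\mathsf{OP}(r_0,\rho)\le\mathcal C^*_{\mathsf{LB}},$$ and, if $r_0\le R\sqrt3/2$, $$\mathcal C^*_{\mathsf{LB}}\le\Big(1+\frac{\beta^2r_0^{-2\alpha}u}{\bar l(R\sqrt3/2,\rho)}\Big)\Big(\frac{R\sqrt3}{2r_0}\Big)^{2\alpha}\mathsf{OP}(r_0,\rho).$$ -/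

import Mathlib

open MeasureTheory ProbabilityTheory Filter

noncomputable section

/-- The Euclidean plane. -/
abbrev Plane : Type := EuclideanSpace ℝ (Fin 2)

/-- A regular extended network with `B` transmitters and `N` resource blocks: the transmitters are
distinct points of a regular hexagonal grid in which neighbours are at distance `2 * R`. -/
structure HexNetwork (B N : ℕ) where
  /-- half of the distance between neighbouring transmitters -/
  R : ℝ
  /-- truncation radius of the path loss -/
  r₀ : ℝ
  /-- path-loss exponent -/
  α : ℝ
  /-- path-loss constant -/
  β : ℝ
  /-- sum-power constraint of each transmitter -/
  Pcon : ℝ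
  /-- grid coordinates of the transmitters -/
  site : Fin B → ℤ × ℤ
  B_pos : 0 < B
  N_pos : 0 < N
  r₀_pos : 0 < r₀
  r₀_lt_R : r₀ < R
  one_lt_α : 1 < α
  β_pos : 0 < β
  Pcon_pos : 0 < Pcon
  site_injective : Function.Injective site

namespace HexNetwork

/-- The point of the hexagonal grid of spacing `2 * R` with grid coordinates `s`. -/
def gridPoint (R : ℝ) (s : ℤ × ℤ) : Plane :=
  !₂[2 * R * ((s.1 : ℝ) + (s.2 : ℝ) / 2), Real.sqrt 3 * R * (s.2 : ℝ)]

/-- The regular hexagon of inradius `R` centred at `a`, with sides orthogonal to the directions of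
the six nearest grid points. These hexagons, centred at the grid points, tile the plane. -/
def hexagon (R : ℝ) (a : Plane) : Set Plane :=
  {z | |z 0 - a 0| ≤ R ∧
    |(z 0 - a 0) / 2 + Real.sqrt 3 / 2 * (z 1 - a 1)| ≤ R ∧
    |-(z 0 - a 0) / 2 + Real.sqrt 3 / 2 * (z 1 - a 1)| ≤ R}

/-- The law `𝒞𝒩(0, 1)`: independent real and imaginary parts, each of law `𝒩(0, 1/2)`. -/
def complexGaussian : Measure ℂ :=
  ((gaussianReal 0 (1 / 2)).prod (gaussianReal 0 (1 / 2))).map (fun z => (⟨z.1, z.2⟩ : ℂ))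

variable {B N : ℕ} (S : HexNetwork B N)

/-- The position of transmitter `i`. -/
def tx (i : Fin B) : Plane := gridPoint S.R (S.site i)

/-- The cell of transmitter `i`. -/
def cell (i : Fin B) : Set Plane := hexagon S.R (S.tx i)

/-- A realization of the positions of all users and of all fading factors. A user is a pair
`(i, k)`, the `k`-th of the `ρ` users in the cell of transmitter `i`; the fading factors are indexed
by transmitter, user and resource block. -/
abbrev Sample (B N ρ : ℕ) : Type :=
  (Fin B × Fin ρ → Plane) × (Fin B × (Fin B × Fin ρ) × Fin N → ℂ)

/-- The joint law: the users of each cell are uniformly distributed in the cell, the fading factors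
have law `𝒞𝒩(0, 1)` (Rayleigh fading), and all these variables are independent. -/
def law (ρ : ℕ) : Measure (Sample B N ρ) :=
  (Measure.pi fun k : Fin B × Fin ρ => cond volume (S.cell k.1)).prod
    (Measure.pi fun _ : Fin B × (Fin B × Fin ρ) × Fin N => complexGaussian)

/-- The truncated distance between transmitter `i` and user `k`. -/
def truncDist {ρ : ℕ} (ω : Sample B N ρ) (i : Fin B) (k : Fin B × Fin ρ) : ℝ :=
  max S.r₀ (dist (ω.1 k) (S.tx i))

/-- The channel gain between transmitter `i` and user `k` over resource block `n`. -/
def gain {ρ : ℕ} (ω : Sample B N ρ) (i : Fin B) (k : Fin B × Fin ρ) (n : Fin N) : ℂ :=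
  ((S.β * S.truncDist ω i k ^ (-S.α) : ℝ) : ℂ) * ω.2 (i, k, n)

/-- The signal-to-noise ratio between transmitter `i` and user `k` over resource block `n`. -/
def snr {ρ : ℕ} (ω : Sample B N ρ) (i : Fin B) (k : Fin B × Fin ρ) (n : Fin N) : ℝ :=
  ‖S.gain ω i k n‖ ^ 2

/-- The feasible power allocations. -/
def powers : Set (Fin B → Fin N → ℝ) :=
  {q | (∀ i n, 0 ≤ q i n) ∧ ∀ i, ∑ n, q i n ≤ S.Pcon}

/-- The sum-rate for the power allocation `q` when transmitter `i` serves the user `(i, u i n)` of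
its own cell over resource block `n`. -/
def sumRate {ρ : ℕ} (q : Fin B → Fin N → ℝ) (u : Fin B → Fin N → Fin ρ) (ω : Sample B N ρ) : ℝ :=
  ∑ i, ∑ n, Real.log (1 + S.snr ω i (i, u i n) n * q i n /
    (1 + ∑ j ∈ Finset.univ.erase i, S.snr ω j (i, u i n) n * q j n))

/-- The largest sum-rate over all in-cell user allocations, for the power allocation `q`. -/
def bestSumRate {ρ : ℕ} (q : Fin B → Fin N → ℝ) (ω : Sample B N ρ) : ℝ :=
  ⨆ u : Fin B → Fin N → Fin ρ, S.sumRate q u ω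

/-- The expected best sum-rates of the feasible power allocations. -/
def expectedRates (ρ : ℕ) : Set ℝ :=
  {v | ∃ q ∈ S.powers, v = ∫ ω, S.bestSumRate q ω ∂(S.law ρ)}

/-- `C*_LB` with in-cell scheduling and `ρ` users in each cell. -/
def CLB (ρ : ℕ) : ℝ := sSup (S.expectedRates ρ)

/-- The values of the objective of the problem `OP(c, h)` at its feasible points. -/
def opValues (p c h : ℝ) : Set ℝ :=
  {v | ∃ q ∈ S.powers, ∃ x : Fin B → Fin N → ℝ,
    (∀ i n, 0 ≤ x i n ∧
      S.r₀ ^ 2 * h / p ^ 2 = Real.exp (x i n / (S.β ^ 2 * S.r₀ ^ (-2 * S.α))) *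
        ∏ j ∈ Finset.univ.erase i,
          (1 + q j n * x i n / (c ^ (2 * S.α) * S.r₀ ^ (-2 * S.α)))) ∧
    v = ∑ i, ∑ n, Real.log (1 + q i n * x i n)}

/-- The optimal value `OP(c, h)`. -/
def OP (p c h : ℝ) : ℝ := sSup (S.opValues p c h)

/-- The equation that defines `l̄(c, h)`. -/
def IsLbar (p c h l : ℝ) : Prop :=
  0 < l ∧ S.r₀ ^ 2 * h / p ^ 2 = Real.exp (l / (S.β ^ 2 * S.r₀ ^ (-2 * S.α))) *
    (1 + l * S.Pcon / (c ^ (2 * S.α) * S.r₀ ^ (-2 * S.α))) ^ (B - 1)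

end HexNetwork

end

/-! The squared modulus of a Rayleigh factor is exponential, so for a link with mean gain `a =
peakGain` the probability that the ratio of signal to interference plus noise exceeds `x` is exactly
the reciprocal of `exp (x / a) * ∏ (1 + q j * x / M)`, once the interferers have mean gain `a / M`.
This product is `levelCurve`, and the constraint of OP says that it equals a multiple of the number
`h` of users; hence `x` is the level that the best of about `h` users reaches.

The positions of the users affect this only by constant factors: own gains are at most `a` and equal
`a` with positive probability, and interfering gains lie between two positive constants. Changing
`M` costs a bounded factor in `levelCurve` (`levelCurve_le_mul`), a constant factor is compensated
by a bounded shift of `x` (`levelCurve_sub_le`), and `x` is of order `a * log h` uniformly in the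
powers. A bounded shift therefore changes each rate by `O(1 / log h)`. Since OP tends to infinity
(`tendsto_OP_atTop`), the relative margins `1 / log ρ` and `a * u / l` absorb all such constants.

The upper bound estimates the best rate by the rate at a level plus the total mean excess over it
(`exists_integral_bestRate_le`). It works for every interferer distance `c`, so `c = r₀` is as good
as `c = R√3/2`. The lower bound uses that some user exceeds a level with high probability
(`exists_le_integral_bestRate`); replacing `ρ` by `ρ / log log ρ` makes the failure probability at
most `1 / (log ρ) ^ 2`. The bound with 0.63 follows because this replacement hardly changes `log h`.
-/

/-! ### Growth of the solutions of exponential-polynomial equations. -/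

lemma exists_exp_mul_prod_eq {ι : Type*} (s : Finset ι) {a M H : ℝ} (ha : 0 < a) (hM : 0 < M)
    (hH : 1 ≤ H) (w : ι → ℝ) (hw : ∀ j ∈ s, 0 ≤ w j) :
    ∃ x, 0 ≤ x ∧ H = Real.exp (x / a) * ∏ j ∈ s, (1 + w j * x / M) := by
  -- At `a * log H` the exponential factor alone equals `H`, and the other factors are at least one.
  have h0 : 0 ≤ a * Real.log H := mul_nonneg ha.le (Real.log_nonneg hH)
  have hc : ContinuousOn (fun x : ℝ => Real.exp (x / a) * ∏ j ∈ s, (1 + w j * x / M))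
      (Set.Icc 0 (a * Real.log H)) := by fun_prop
  have := intermediate_value_Icc h0 hc
  obtain ⟨x, hx, hxe⟩ := this (show H ∈ Set.Icc _ _ from by
    constructor
    · simpa using hH
    · have : Real.exp (a * Real.log H / a) = H := by
        rw [mul_div_cancel_left₀ _ ha.ne', Real.exp_log (by linarith)]
      simp only [this]
      refine le_mul_of_one_le_right (by linarith) (Finset.one_le_prod fun j hj => ?_)
      have := hw j hj
      have : 0 ≤ w j * (a * Real.log H) / M := by positivity
      linarith)
  exact ⟨x, hx.1, hxe.symm⟩

lemma le_mul_log_of_exp_div_le {a H x : ℝ} (ha : 0 < a) (h : Real.exp (x / a) ≤ H) :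
    x ≤ a * Real.log H := by
  have := (Real.le_log_iff_exp_le ((Real.exp_pos _).trans_le h)).2 h
  rwa [div_le_iff₀' ha] at this

lemma eventually_mul_log_one_add_le (C ε : ℝ) (m : ℕ) (hC : 0 ≤ C) (hε : 0 < ε) :
    ∀ᶠ L : ℝ in atTop, m * Real.log (1 + C * L) ≤ ε * L := by
  have h1 : (fun L : ℝ => Real.log (1 + C * L)) =o[atTop] (fun L : ℝ => L) := by
    have h2 : (fun L : ℝ => Real.log ((1 + C) * L)) =o[atTop] (fun L : ℝ => L) := by
      have h3 : (fun L : ℝ => Real.log (1 + C) + Real.log L) =o[atTop] (fun L : ℝ => L) :=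
        (Asymptotics.isLittleO_const_id_atTop _).add Real.isLittleO_log_id_atTop
      refine h3.congr' ?_ EventuallyEq.rfl
      filter_upwards [eventually_gt_atTop 0] with L hL
      rw [Real.log_mul (by positivity) hL.ne']
    refine Asymptotics.IsBigO.trans_isLittleO ?_ h2
    refine Asymptotics.IsBigO.of_bound 1 ?_
    filter_upwards [eventually_ge_atTop 1] with L hL
    have h5 : 1 ≤ 1 + C * L := by nlinarith
    have h6 : 1 + C * L ≤ (1 + C) * L := by nlinarith
    rw [one_mul, Real.norm_of_nonneg (Real.log_nonneg h5),
      Real.norm_of_nonneg (Real.log_nonneg (h5.trans h6))]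
    exact Real.log_le_log (by linarith) h6
  have h7 := h1.const_mul_left (m : ℝ)
  filter_upwards [h7.def hε, eventually_ge_atTop 0] with L hL hL0
  rw [Real.norm_of_nonneg hL0] at hL
  exact (Real.le_norm_self _).trans hL

/-- A solution of an equation `H ≤ exp (x / a) * (1 + C * x) ^ m` is at least of the order of
`a * log H`. -/
lemma eventually_mul_log_le_of_le_exp_mul_pow {a C θ : ℝ} (m : ℕ) (ha : 0 < a) (hC : 0 ≤ C)
    (hθ : θ < 1) :
    ∀ᶠ H : ℝ in atTop, ∀ x, 0 ≤ x → H ≤ Real.exp (x / a) * (1 + C * x) ^ m →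
      θ * (a * Real.log H) ≤ x := by
  have h := Real.tendsto_log_atTop.eventually
    (eventually_mul_log_one_add_le (C * a) ((1 - θ) / 2) m (by positivity) (by linarith))
  filter_upwards [h, eventually_gt_atTop 1] with H hH hH1 x hx hle
  -- Otherwise, taking logarithms, `log H ≤ x / a + m * log (1 + C * x)`, where the first term is
  -- below `θ * log H` and the second is at most `(1 - θ) / 2 * log H`.
  by_contra! hlt
  have hL : 0 < Real.log H := Real.log_pos hH1
  have hxL : x ≤ a * Real.log H := by
    refine hlt.le.trans ?_
    have : 0 < a * Real.log H := by positivity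
    nlinarith
  have h1 : Real.log H ≤ x / a + m * Real.log (1 + C * x) := by
    have := Real.log_le_log (by linarith) hle
    rwa [Real.log_mul (by positivity) (by positivity), Real.log_exp, Real.log_pow] at this
  have h2 : Real.log (1 + C * x) ≤ Real.log (1 + C * a * Real.log H) := by
    apply Real.log_le_log (by positivity)
    have := mul_le_mul_of_nonneg_left hxL hC
    linarith
  have h3 : x / a < θ * Real.log H := by
    rw [div_lt_iff₀ ha]; linarith
  have h4 : (m : ℝ) * Real.log (1 + C * x) ≤ m * Real.log (1 + C * a * Real.log H) := by gcongr
  nlinarith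

/-! ### Level curves, the problem OP and the equation for l̄. -/

namespace HexNetwork

variable {B N : ℕ} (S : HexNetwork B N)

/-- The largest mean signal-to-noise ratio, that of a user within the truncation radius. -/
noncomputable def peakGain : ℝ := S.β ^ 2 * S.r₀ ^ (-2 * S.α)

/-- The reciprocal of the probability that the interfered link of transmitter `i` exceeds the level
`x`, when the interferers are attenuated by the factor `M`. -/
noncomputable def levelCurve (M : ℝ) (q : Fin B → Fin N → ℝ) (i : Fin B) (n : Fin N) (x : ℝ) : ℝ :=
  Real.exp (x / S.peakGain) * ∏ j ∈ Finset.univ.erase i, (1 + q j n * x / M)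

/-- The attenuation of interferers at distance `c`. -/
noncomputable def attenuation (c : ℝ) : ℝ := c ^ (2 * S.α) * S.r₀ ^ (-2 * S.α)

lemma peakGain_pos : 0 < S.peakGain := by
  have := S.β_pos; have := S.r₀_pos; unfold peakGain; positivity

lemma attenuation_pos {c : ℝ} (hc : 0 < c) : 0 < S.attenuation c := by
  have := S.r₀_pos; unfold attenuation; positivity

/-- Hence the problem with `c = r₀` treats every interferer as if it had the peak mean gain. -/
lemma attenuation_r₀ : S.attenuation S.r₀ = 1 := by
  unfold attenuation
  rw [← Real.rpow_add S.r₀_pos]; simp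

lemma powers_le {q : Fin B → Fin N → ℝ} (hq : q ∈ S.powers) (i : Fin B) (n : Fin N) :
    q i n ≤ S.Pcon :=
  (Finset.single_le_sum (fun m _ => hq.1 i m) (Finset.mem_univ n)).trans (hq.2 i)

lemma isCompact_powers : IsCompact S.powers := by
  refine (isCompact_univ_pi fun _ : Fin B => isCompact_univ_pi fun _ : Fin N =>
    (isCompact_Icc : IsCompact (Set.Icc 0 S.Pcon))).of_isClosed_subset ?_ ?_
  · have : S.powers = (⋂ i, ⋂ n, {q : Fin B → Fin N → ℝ | 0 ≤ q i n}) ∩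
        ⋂ i, {q : Fin B → Fin N → ℝ | ∑ n, q i n ≤ S.Pcon} := by
      ext q; simp [powers]
    rw [this]
    refine IsClosed.inter (isClosed_iInter fun i => isClosed_iInter fun n => ?_)
      (isClosed_iInter fun i => ?_)
    · exact isClosed_le continuous_const (by fun_prop)
    · exact isClosed_le (by fun_prop) continuous_const
  · intro q hq i _ n _
    exact ⟨hq.1 i n, S.powers_le hq i n⟩

lemma uniform_mem_powers : (fun (_ : Fin B) (_ : Fin N) => S.Pcon / N) ∈ S.powers := by
  have h := S.Pcon_pos
  have hN : (0 : ℝ) < N := by exact_mod_cast S.N_pos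
  refine ⟨fun _ _ => by positivity, fun _ => ?_⟩
  simp [mul_div_cancel₀ _ hN.ne']

lemma levelCurve_pos {M : ℝ} (hM : 0 < M) {q : Fin B → Fin N → ℝ} (hq : q ∈ S.powers)
    (i : Fin B) (n : Fin N) {x : ℝ} (hx : 0 ≤ x) : 0 < S.levelCurve M q i n x := by
  refine mul_pos (Real.exp_pos _) (Finset.prod_pos fun j _ => ?_)
  have := hq.1 j n
  positivity

lemma exp_le_levelCurve {M : ℝ} (hM : 0 < M) {q : Fin B → Fin N → ℝ} (hq : q ∈ S.powers)
    (i : Fin B) (n : Fin N) {x : ℝ} (hx : 0 ≤ x) :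
    Real.exp (x / S.peakGain) ≤ S.levelCurve M q i n x := by
  refine le_mul_of_one_le_right (Real.exp_pos _).le (Finset.one_le_prod fun j _ => ?_)
  have := hq.1 j n
  have : 0 ≤ q j n * x / M := by positivity
  linarith

lemma levelCurve_le {M : ℝ} (hM : 0 < M) {q : Fin B → Fin N → ℝ} (hq : q ∈ S.powers)
    (i : Fin B) (n : Fin N) {x : ℝ} (hx : 0 ≤ x) :
    S.levelCurve M q i n x ≤
      Real.exp (x / S.peakGain) * (1 + S.Pcon / M * x) ^ (Finset.univ.erase i).card := by
  refine mul_le_mul_of_nonneg_left ?_ (Real.exp_pos _).le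
  rw [← Finset.prod_const]
  refine Finset.prod_le_prod (fun j _ => ?_) fun j _ => ?_
  · have := hq.1 j n
    positivity
  · have : q j n * x / M ≤ S.Pcon * x / M := by gcongr; exact S.powers_le hq j n
    linarith [div_mul_eq_mul_div S.Pcon M x]

/-- Each factor satisfies `1 + w / M' ≤ (1 + M / M') * (1 + w / M)`. The constant depends neither on
the powers nor on the level, which is why the distance of the interferers is asymptotically
irrelevant. -/
lemma levelCurve_le_mul {M M' : ℝ} (hM : 0 < M) (hM' : 0 < M') {q : Fin B → Fin N → ℝ}
    (hq : q ∈ S.powers) (i : Fin B) (n : Fin N) {x : ℝ} (hx : 0 ≤ x) :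
    S.levelCurve M' q i n x ≤ (1 + M / M') ^ B * S.levelCurve M q i n x := by
  have h1 : ∏ j ∈ Finset.univ.erase i, (1 + q j n * x / M') ≤
      ∏ j ∈ Finset.univ.erase i, ((1 + M / M') * (1 + q j n * x / M)) := by
    refine Finset.prod_le_prod (fun j _ => ?_) fun j _ => ?_
    · have := hq.1 j n
      positivity
    · have := hq.1 j n
      have h2 : M / M' * (q j n * x / M) = q j n * x / M' := by field_simp
      have h3 : 0 ≤ q j n * x / M := by positivity
      have h4 : 0 ≤ M / M' := by positivity
      nlinarith
  rw [Finset.prod_mul_distrib, Finset.prod_const] at h1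
  have h5 : (1 + M / M') ^ (Finset.univ.erase i).card ≤ (1 + M / M') ^ B := by
    refine pow_le_pow_right₀ (by have : 0 < M / M' := by positivity
                                 linarith) ?_
    simp
  have h6 : 0 ≤ ∏ j ∈ Finset.univ.erase i, (1 + q j n * x / M) :=
    Finset.prod_nonneg fun j _ => by have := hq.1 j n; positivity
  unfold levelCurve
  calc _ ≤ Real.exp (x / S.peakGain) * ((1 + M / M') ^ B *
        ∏ j ∈ Finset.univ.erase i, (1 + q j n * x / M)) := by
        refine mul_le_mul_of_nonneg_left (h1.trans ?_) (Real.exp_pos _).le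
        exact mul_le_mul_of_nonneg_right h5 h6
    _ = _ := by ring

/-- The exponential factor gains `exp (-K)` and the product can only decrease: any constant factor
is bought by a bounded shift of the level. -/
lemma levelCurve_sub_le {M : ℝ} (hM : 0 < M) {q : Fin B → Fin N → ℝ} (hq : q ∈ S.powers)
    (i : Fin B) (n : Fin N) {x K : ℝ} (hK : 0 ≤ K) (hx : S.peakGain * K ≤ x) :
    S.levelCurve M q i n (x - S.peakGain * K) ≤ Real.exp (-K) * S.levelCurve M q i n x := by
  have ha := S.peakGain_pos
  have h0 : 0 ≤ S.peakGain * K := by positivity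
  have h1 : ∏ j ∈ Finset.univ.erase i, (1 + q j n * (x - S.peakGain * K) / M) ≤
      ∏ j ∈ Finset.univ.erase i, (1 + q j n * x / M) := by
    refine Finset.prod_le_prod (fun j _ => ?_) fun j _ => ?_
    · have := hq.1 j n
      have : 0 ≤ x - S.peakGain * K := by linarith
      positivity
    · have := hq.1 j n
      gcongr
      linarith
  unfold levelCurve
  have h2 : Real.exp ((x - S.peakGain * K) / S.peakGain) =
      Real.exp (-K) * Real.exp (x / S.peakGain) := by
    rw [← Real.exp_add]; congr 1; field_simp; ring
  rw [h2, mul_assoc (Real.exp (-K))]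
  gcongr

lemma le_mul_log_of_levelCurve {M H : ℝ} (hM : 0 < M) {q : Fin B → Fin N → ℝ}
    (hq : q ∈ S.powers) (i : Fin B) (n : Fin N) {x : ℝ} (hx : 0 ≤ x)
    (h : H = S.levelCurve M q i n x) : x ≤ S.peakGain * Real.log H :=
  le_mul_log_of_exp_div_le S.peakGain_pos (h ▸ S.exp_le_levelCurve hM hq i n hx)

/-- Together with `le_mul_log_of_levelCurve` this gives `x ~ peakGain * log H`, uniformly over all
power allocations. -/
lemma eventually_le_of_levelCurve {M θ : ℝ} (hM : 0 < M) (hθ : θ < 1) :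
    ∀ᶠ H : ℝ in atTop, ∀ q ∈ S.powers, ∀ i n x, 0 ≤ x → H = S.levelCurve M q i n x →
      θ * (S.peakGain * Real.log H) ≤ x := by
  have hP := S.Pcon_pos
  filter_upwards [eventually_mul_log_le_of_le_exp_mul_pow (B - 1) S.peakGain_pos
    (show 0 ≤ S.Pcon / M by positivity) hθ] with H hH q hq i n x hx h
  refine hH x hx (h.trans_le ((S.levelCurve_le hM hq i n hx).trans_eq ?_))
  simp [Finset.card_erase_of_mem]

lemma mem_opValues_iff {p c h v : ℝ} : v ∈ S.opValues p c h ↔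
    ∃ q ∈ S.powers, ∃ x : Fin B → Fin N → ℝ,
      (∀ i n, 0 ≤ x i n ∧ S.r₀ ^ 2 * h / p ^ 2 = S.levelCurve (S.attenuation c) q i n (x i n)) ∧
      v = ∑ i, ∑ n, Real.log (1 + q i n * x i n) := Iff.rfl

lemma exists_levelCurve_eq {M H : ℝ} (hM : 0 < M) (hH : 1 ≤ H) {q : Fin B → Fin N → ℝ}
    (hq : q ∈ S.powers) :
    ∃ x : Fin B → Fin N → ℝ, ∀ i n, 0 ≤ x i n ∧ H = S.levelCurve M q i n (x i n) := by
  have : ∀ i n, ∃ x, 0 ≤ x ∧ H = S.levelCurve M q i n x := fun i n =>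
    exists_exp_mul_prod_eq (Finset.univ.erase i) S.peakGain_pos hM hH (fun j => q j n)
      fun j _ => hq.1 j n
  choose x hx using this
  exact ⟨x, hx⟩

/-- The feasible pairs `(q, x)` form a compact set, closed by continuity and bounded because `x ≤
peakGain * log H`. Working with pairs makes it unnecessary to know that `x` depends continuously on
`q`. -/
lemma isGreatest_opValues {p c h : ℝ} (hc : 0 < c) (hH : 1 ≤ S.r₀ ^ 2 * h / p ^ 2) :
    IsGreatest (S.opValues p c h) (S.OP p c h) := by
  set H := S.r₀ ^ 2 * h / p ^ 2 with hHdef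
  have hM := S.attenuation_pos hc
  set M := S.attenuation c
  let K : Set ((Fin B → Fin N → ℝ) × (Fin B → Fin N → ℝ)) :=
    (S.powers ×ˢ Set.univ.pi fun _ => Set.univ.pi fun _ => Set.Icc 0 (S.peakGain * Real.log H)) ∩
      ⋂ i, ⋂ n, {z | H = S.levelCurve M z.1 i n (z.2 i n)}
  have hK : IsCompact K := by
    refine (S.isCompact_powers.prod (isCompact_univ_pi fun _ => isCompact_univ_pi fun _ =>
      isCompact_Icc)).inter_right (isClosed_iInter fun i => isClosed_iInter fun n => ?_)
    refine isClosed_eq continuous_const ?_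
    unfold levelCurve
    fun_prop
  have himg : S.opValues p c h =
      (fun z : (Fin B → Fin N → ℝ) × (Fin B → Fin N → ℝ) =>
        ∑ i, ∑ n, Real.log (1 + z.1 i n * z.2 i n)) '' K := by
    ext v
    rw [S.mem_opValues_iff]
    constructor
    · rintro ⟨q, hq, x, hx, rfl⟩
      refine ⟨(q, x), ⟨⟨hq, fun i _ n _ => ⟨(hx i n).1, ?_⟩⟩, ?_⟩, rfl⟩
      · exact S.le_mul_log_of_levelCurve hM hq i n (hx i n).1 (hx i n).2
      · simpa using fun i n => (hx i n).2
    · rintro ⟨⟨q, x⟩, ⟨⟨hq, hx⟩, hx'⟩, rfl⟩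
      simp only [Set.mem_iInter, Set.mem_ofPred_eq] at hx'
      exact ⟨q, hq, x, fun i n => ⟨(hx i trivial n trivial).1, hx' i n⟩, rfl⟩
  have hcomp : IsCompact (S.opValues p c h) := by
    rw [himg]
    refine hK.image_of_continuousOn ?_
    refine continuousOn_finsetSum _ fun i _ => continuousOn_finsetSum _ fun n _ => ?_
    refine ContinuousOn.log (by fun_prop) ?_
    rintro ⟨q, x⟩ ⟨⟨hq, hx⟩, -⟩
    have h1 := hq.1 i n
    have h2 := (hx i trivial n trivial).1
    have : 0 ≤ q i n * x i n := mul_nonneg h1 h2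
    show (1 + q i n * x i n) ≠ 0
    linarith
  refine hcomp.isGreatest_sSup ?_
  obtain ⟨x, hx⟩ := S.exists_levelCurve_eq hM hH S.uniform_mem_powers
  exact ⟨_, S.mem_opValues_iff.2 ⟨_, S.uniform_mem_powers, x, hx, rfl⟩⟩

lemma tendsto_normalized_atTop {p : ℝ} (hp : 0 < p) :
    Tendsto (fun h : ℝ => S.r₀ ^ 2 * h / p ^ 2) atTop atTop := by
  have := S.r₀_pos
  have : (fun h : ℝ => S.r₀ ^ 2 * h / p ^ 2) = fun h => (S.r₀ ^ 2 / p ^ 2) * h := by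
    ext h; ring
  rw [this]
  exact tendsto_id.const_mul_atTop (by positivity)

/-- A single term of the objective at uniform power already diverges, like `log log h`. This
divergence absorbs the additive constants in all the bounds. -/
lemma tendsto_OP_atTop {p c : ℝ} (hp : 0 < p) (hc : 0 < c) :
    Tendsto (fun h : ℝ => S.OP p c h) atTop atTop := by
  have hM := S.attenuation_pos hc
  have ha := S.peakGain_pos
  have hP := S.Pcon_pos
  have hN : (0 : ℝ) < N := by exact_mod_cast S.N_pos
  have hH := S.tendsto_normalized_atTop hp
  have hlog : Tendsto (fun h : ℝ => Real.log (1 + S.Pcon / N *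
      (2⁻¹ * (S.peakGain * Real.log (S.r₀ ^ 2 * h / p ^ 2))))) atTop atTop := by
    refine Real.tendsto_log_atTop.comp (tendsto_atTop_add_const_left _ _ ?_)
    refine Tendsto.const_mul_atTop (by positivity) (Tendsto.const_mul_atTop (by positivity)
      (Tendsto.const_mul_atTop (by positivity) (Real.tendsto_log_atTop.comp hH)))
  refine tendsto_atTop_mono' _ ?_ hlog
  filter_upwards [hH.eventually_ge_atTop 1, hH.eventually
    (S.eventually_le_of_levelCurve hM (θ := 2⁻¹) (by norm_num))] with h h1 h2
  obtain ⟨x, hx⟩ := S.exists_levelCurve_eq hM h1 S.uniform_mem_powers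
  refine le_trans ?_ ((S.isGreatest_opValues hc h1).2
    (S.mem_opValues_iff.2 ⟨_, S.uniform_mem_powers, x, hx, rfl⟩))
  have hnn : ∀ i n, 0 ≤ Real.log (1 + S.Pcon / N * x i n) := fun i n => by
    have := (hx i n).1
    refine Real.log_nonneg ?_
    have : 0 ≤ S.Pcon / N * x i n := by positivity
    linarith
  let i₀ : Fin B := ⟨0, S.B_pos⟩
  let n₀ : Fin N := ⟨0, S.N_pos⟩
  calc _ ≤ Real.log (1 + S.Pcon / N * x i₀ n₀) := by
        have h3 := h2 _ S.uniform_mem_powers i₀ n₀ _ (hx i₀ n₀).1 (hx i₀ n₀).2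
        have h4 : 0 ≤ Real.log (S.r₀ ^ 2 * h / p ^ 2) := Real.log_nonneg h1
        refine Real.log_le_log (by positivity) ?_
        gcongr
    _ ≤ ∑ n, Real.log (1 + S.Pcon / N * x i₀ n) :=
        Finset.single_le_sum (fun n _ => hnn i₀ n) (Finset.mem_univ n₀)
    _ ≤ _ := Finset.single_le_sum (f := fun i => ∑ n, Real.log (1 + S.Pcon / N * x i n))
        (fun i _ => Finset.sum_nonneg fun n _ => hnn i n) (Finset.mem_univ i₀)

lemma IsLbar.le_mul_log {p c h l : ℝ} (hc : 0 < c) (hl : S.IsLbar p c h l) :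
    l ≤ S.peakGain * Real.log (S.r₀ ^ 2 * h / p ^ 2) := by
  have hM := S.attenuation_pos hc
  have hP := S.Pcon_pos
  have h0 := hl.1
  refine le_mul_log_of_exp_div_le S.peakGain_pos (hl.2 ▸ ?_)
  refine le_mul_of_one_le_right (Real.exp_pos _).le (one_le_pow₀ ?_)
  have : 0 ≤ l * S.Pcon / S.attenuation c := by positivity
  unfold attenuation at this
  linarith

lemma existsUnique_isLbar {p c h : ℝ} (hc : 0 < c) (hH : 1 < S.r₀ ^ 2 * h / p ^ 2) :
    ∃! l, S.IsLbar p c h l := by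
  have ha := S.peakGain_pos
  have hM := S.attenuation_pos hc
  have hP := S.Pcon_pos
  have hmono : ∀ x y : ℝ, 0 ≤ x → x < y →
      Real.exp (x / S.peakGain) * (1 + x * S.Pcon / S.attenuation c) ^ (B - 1) <
        Real.exp (y / S.peakGain) * (1 + y * S.Pcon / S.attenuation c) ^ (B - 1) := by
    intro x y hx hxy
    have h1 : 1 + x * S.Pcon / S.attenuation c ≤ 1 + y * S.Pcon / S.attenuation c := by gcongr
    exact mul_lt_mul (Real.exp_lt_exp.2 (by gcongr)) (pow_le_pow_left₀ (by positivity) h1 _)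
      (by positivity) (Real.exp_pos _).le
  obtain ⟨l, hl, hle⟩ := exists_exp_mul_prod_eq (Finset.range (B - 1)) ha hM hH.le
    (fun _ => S.Pcon) fun _ _ => hP.le
  rw [Finset.prod_const, Finset.card_range, mul_comm S.Pcon] at hle
  have hl0 : l ≠ 0 := by
    rintro rfl
    simp at hle
    linarith
  refine ⟨l, ⟨lt_of_le_of_ne hl hl0.symm, hle⟩, ?_⟩
  rintro y ⟨hy, hye⟩
  have hye' : S.r₀ ^ 2 * h / p ^ 2 = Real.exp (y / S.peakGain) *
      (1 + y * S.Pcon / S.attenuation c) ^ (B - 1) := hye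
  rcases lt_trichotomy y l with hyl | hyl | hyl
  · linarith [hmono y l hy.le hyl]
  · exact hyl
  · linarith [hmono l y hl hyl]

end HexNetwork

/-! ### The squared modulus of a complex Gaussian is exponential. -/

/-- The exponential law of rate one. -/
noncomputable def unitExponential : Measure ℝ :=
  (volume.restrict (Set.Ioi 0)).withDensity fun s => ENNReal.ofReal (Real.exp (-s))

lemma lintegral_unitExponential (g : ℝ → ENNReal) (hg : Measurable g) :
    ∫⁻ s, g s ∂unitExponential = ∫⁻ s in Set.Ioi 0, ENNReal.ofReal (Real.exp (-s)) * g s := by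
  unfold unitExponential
  rw [lintegral_withDensity_eq_lintegral_mul _ (by fun_prop) hg]
  rfl

lemma gaussianPDF_mul_gaussianPDF (x y : ℝ) :
    gaussianPDF 0 (1 / 2) x * gaussianPDF 0 (1 / 2) y =
      ENNReal.ofReal (Real.pi⁻¹ * Real.exp (-(x ^ 2 + y ^ 2))) := by
  rw [gaussianPDF, gaussianPDF, ← ENNReal.ofReal_mul (gaussianPDFReal_nonneg _ _ _)]
  congr 1
  simp only [gaussianPDFReal]
  have h : (((1 / 2 : NNReal)) : ℝ) = 1 / 2 := by norm_num
  rw [h]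
  have h2 : 2 * Real.pi * (1 / 2) = Real.pi := by ring
  rw [h2, mul_mul_mul_comm, ← Real.exp_add, ← mul_inv, Real.mul_self_sqrt Real.pi_pos.le]
  congr 2
  ring

/-- In polar coordinates the density is `π⁻¹ * exp (-r ^ 2) * r`; the angle contributes `2 * π` and
the substitution `s = r ^ 2` leaves `exp (-s)`. -/
lemma lintegral_complexGaussian_norm_sq (g : ℝ → ENNReal) (hg : Measurable g) :
    ∫⁻ z, g (‖z‖ ^ 2) ∂HexNetwork.complexGaussian = ∫⁻ s, g s ∂unitExponential := by
  have hmk : Measurable fun z : ℝ × ℝ => (⟨z.1, z.2⟩ : ℂ) :=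
    Complex.measurableEquivRealProd.symm.measurable
  have hv : (1 / 2 : NNReal) ≠ 0 := by norm_num
  have hnorm : ∀ x y : ℝ, ‖(⟨x, y⟩ : ℂ)‖ ^ 2 = x ^ 2 + y ^ 2 := fun x y => by
    rw [← Complex.normSq_eq_norm_sq, Complex.normSq_mk]; ring
  rw [HexNetwork.complexGaussian, lintegral_map (by fun_prop) hmk,
    gaussianReal_of_var_ne_zero _ hv,
    prod_withDensity (measurable_gaussianPDF _ _) (measurable_gaussianPDF _ _),
    lintegral_withDensity_eq_lintegral_mul _ (by fun_prop) (by fun_prop),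
    lintegral_unitExponential g hg]
  simp only [Pi.mul_apply, gaussianPDF_mul_gaussianPDF, hnorm]
  rw [← Measure.volume_eq_prod, ← lintegral_comp_polarCoord_symm]
  have htarget : polarCoord.target = Set.Ioi (0 : ℝ) ×ˢ Set.Ioo (-Real.pi) Real.pi := rfl
  have hpolar : ∀ r : ℝ × ℝ, (polarCoord.symm r).1 ^ 2 + (polarCoord.symm r).2 ^ 2 = r.1 ^ 2 := by
    intro r
    simp only [polarCoord_symm_apply]
    nlinarith [Real.sin_sq_add_cos_sq r.2]
  simp only [hpolar, smul_eq_mul]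
  rw [htarget, Measure.volume_eq_prod, ← Measure.prod_restrict,
    lintegral_prod _ (by fun_prop)]
  simp only [lintegral_const, Measure.restrict_apply MeasurableSet.univ, Set.univ_inter,
    Real.volume_Ioo]
  have himg : (fun r : ℝ => r ^ 2) '' Set.Ioi 0 = Set.Ioi 0 := by
    ext s
    constructor
    · rintro ⟨r, hr, rfl⟩
      exact pow_pos (Set.mem_Ioi.1 hr) 2
    · intro hs
      exact ⟨√s, Real.sqrt_pos.2 hs, Real.sq_sqrt (le_of_lt hs)⟩
  have hinj : Set.InjOn (fun r : ℝ => r ^ 2) (Set.Ioi 0) := by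
    intro x hx y hy hxy
    exact (pow_left_inj₀ (le_of_lt hx) (le_of_lt hy) two_ne_zero).1 hxy
  conv_rhs => rw [← himg]
  rw [lintegral_image_eq_lintegral_abs_deriv_mul measurableSet_Ioi
    (f := fun r : ℝ => r ^ 2) (f' := fun r => 2 * r)
    (fun r _ => by simpa using (hasDerivAt_pow 2 r).hasDerivWithinAt) hinj]
  refine setLIntegral_congr_fun measurableSet_Ioi fun r hr => ?_
  have hr0 : (0 : ℝ) < r := hr
  rw [← mul_assoc, ← mul_assoc, mul_right_comm, ← ENNReal.ofReal_mul hr0.le,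
    ← ENNReal.ofReal_mul (by positivity), ← ENNReal.ofReal_mul (by positivity), abs_of_pos (by positivity)]
  congr 2
  field_simp
  ring

lemma map_norm_sq_complexGaussian :
    HexNetwork.complexGaussian.map (fun z => ‖z‖ ^ 2) = unitExponential := by
  refine Measure.ext_of_lintegral _ fun g hg => ?_
  rw [lintegral_map hg (by fun_prop), lintegral_complexGaussian_norm_sq g hg]

lemma unitExponential_Ici {w : ℝ} (hw : 0 ≤ w) :
    unitExponential (Set.Ici w) = ENNReal.ofReal (Real.exp (-w)) := by
  rw [unitExponential, withDensity_apply _ measurableSet_Ici,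
    Measure.restrict_restrict measurableSet_Ici]
  have : (Set.Ici w ∩ Set.Ioi 0 : Set ℝ) =ᵐ[volume] Set.Ioi w := by
    rcases hw.eq_or_lt with rfl | h
    · have h0 : (Set.Ici 0 ∩ Set.Ioi 0 : Set ℝ) = Set.Ioi 0 :=
        Set.inter_eq_right.2 Set.Ioi_subset_Ici_self
      rw [h0]
      exact EventuallyEq.rfl
    · have h0 : (Set.Ici w ∩ Set.Ioi 0 : Set ℝ) = Set.Ici w :=
        Set.inter_eq_left.2 fun s (hs : w ≤ s) => h.trans_le hs
      rw [h0]
      exact Ioi_ae_eq_Ici.symm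
  rw [setLIntegral_congr this, ← ofReal_integral_eq_lintegral_ofReal (integrableOn_exp_neg_Ioi w)
    (ae_of_all _ fun s => (Real.exp_pos _).le), integral_exp_neg_Ioi]

/-- By lack of memory, the excess over `w` has mean one given that it is positive, so its mean
equals the tail probability. -/
lemma lintegral_unitExponential_sub {w : ℝ} (hw : 0 ≤ w) :
    ∫⁻ s, ENNReal.ofReal (s - w) ∂unitExponential = ENNReal.ofReal (Real.exp (-w)) := by
  rw [lintegral_unitExponential _ (by fun_prop)]
  have hsub : Set.Ioi w ⊆ Set.Ioi (0 : ℝ) := Set.Ioi_subset_Ioi hw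
  have h1 : ∫⁻ s in Set.Ioi 0, ENNReal.ofReal (Real.exp (-s)) * ENNReal.ofReal (s - w) =
      ∫⁻ s in Set.Ioi w, ENNReal.ofReal ((s - w) * Real.exp (-s)) := by
    rw [← Set.union_sdiff_cancel hsub, lintegral_union (measurableSet_Ioi.diff measurableSet_Ioi)
      Set.disjoint_sdiff_right, setLIntegral_eq_zero (measurableSet_Ioi.diff measurableSet_Ioi),
      add_zero]
    · refine setLIntegral_congr_fun measurableSet_Ioi fun s hs => ?_
      have : 0 ≤ s - w := sub_nonneg.2 (le_of_lt hs)
      rw [mul_comm, ENNReal.ofReal_mul this]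
    · intro s hs
      have : s - w ≤ 0 := by simpa using hs.2
      simp [ENNReal.ofReal_of_nonpos this]
  rw [h1]
  have hderiv : ∀ s ∈ Set.Ici w, HasDerivAt (fun s : ℝ => -((s - w + 1) * Real.exp (-s)))
      ((s - w) * Real.exp (-s)) s := by
    intro s _
    have h2 : HasDerivAt (fun s : ℝ => s - w + 1) 1 s := ((hasDerivAt_id s).sub_const w).add_const 1
    have h3 : HasDerivAt (fun s : ℝ => Real.exp (-s)) (-Real.exp (-s)) s := by
      simpa using (hasDerivAt_neg s).exp
    exact (h2.mul h3).neg.congr_deriv (by ring)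
  have hlim : Tendsto (fun s : ℝ => -((s - w + 1) * Real.exp (-s))) atTop (nhds 0) := by
    have h4 := Real.tendsto_pow_mul_exp_neg_atTop_nhds_zero 1
    have h5 := (Real.tendsto_pow_mul_exp_neg_atTop_nhds_zero 0).const_mul (1 - w)
    have h6 := (h4.add h5).neg
    simp only [mul_zero, add_zero, neg_zero] at h6
    refine h6.congr fun s => by ring
  have hpos : ∀ s ∈ Set.Ioi w, 0 ≤ (s - w) * Real.exp (-s) := fun s hs =>
    mul_nonneg (sub_nonneg.2 (le_of_lt hs)) (Real.exp_pos _).le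
  have hint := integrableOn_Ioi_deriv_of_nonneg' hderiv hpos hlim
  rw [← ofReal_integral_eq_lintegral_ofReal hint
    ((ae_restrict_iff' measurableSet_Ioi).2 (ae_of_all _ hpos)),
    integral_Ioi_of_hasDerivAt_of_tendsto' hderiv hint hlim]
  congr 1
  ring

lemma lintegral_unitExponential_exp_neg_mul {d : ℝ} (hd : 0 ≤ d) :
    ∫⁻ s, ENNReal.ofReal (Real.exp (-(d * s))) ∂unitExponential =
      ENNReal.ofReal ((1 + d)⁻¹) := by
  rw [lintegral_unitExponential _ (by fun_prop)]
  have h : ∀ s : ℝ, ENNReal.ofReal (Real.exp (-s)) * ENNReal.ofReal (Real.exp (-(d * s))) =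
      ENNReal.ofReal (Real.exp (-(1 + d) * s)) := fun s => by
    rw [← ENNReal.ofReal_mul (Real.exp_pos _).le, ← Real.exp_add]; congr 2; ring
  simp only [h]
  have hd' : -(1 + d) < 0 := by linarith
  rw [← ofReal_integral_eq_lintegral_ofReal (integrableOn_exp_mul_Ioi hd' 0)
    (ae_of_all _ fun s => (Real.exp_pos _).le), integral_exp_mul_Ioi hd']
  congr 1
  rw [mul_zero, Real.exp_zero, neg_div_neg_eq, one_div]

/-! ### Tail and mean excess of an exponential signal under exponential interference. -/

section Interference

variable {Ω ι : Type*} [MeasurableSpace Ω] {μ : Measure Ω} {e : ι → Ω → ℝ}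

open Classical in
lemma indepFun_interference (hind : iIndepFun e μ) (hm : ∀ j, Measurable (e j)) (s : Finset ι)
    (i : ι) (hi : i ∉ s) (d : ι → ℝ) :
    IndepFun (fun ω => 1 + ∑ j ∈ s, d j * e j ω) (e i) μ := by
  -- The sum and the isolated variable must belong to one independent family; setting the
  -- coefficient at `i` to one makes the isolated member `e i` itself.
  have h1 : iIndepFun (fun j ω => Function.update d i 1 j * e j ω) μ :=
    hind.comp (fun j x => Function.update d i 1 j * x) fun j => by fun_prop
  have h2 := h1.indepFun_finsetSum_of_notMem (fun j => by fun_prop) hi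
  have h3 := h2.comp (φ := fun x => 1 + x) (ψ := id) (by fun_prop) measurable_id
  refine h3.congr (Eq.eventuallyEq ?_) (Eq.eventuallyEq ?_)
  · ext ω
    simp only [Function.comp, Finset.sum_apply]
    congr 1
    refine Finset.sum_congr rfl fun j hj => ?_
    rw [Function.update_of_ne (ne_of_mem_of_not_mem hj hi)]
  · ext ω
    simp

/-- The Laplace transform of the interference factors by independence; this is the origin of the
product in `levelCurve`. -/
lemma lintegral_exp_neg_interference (hind : iIndepFun e μ) (hm : ∀ j, Measurable (e j))
    (hlaw : ∀ j, μ.map (e j) = unitExponential) (s : Finset ι) (d : ι → ℝ) (hd : ∀ j ∈ s, 0 ≤ d j)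
    {x : ℝ} (hx : 0 ≤ x) :
    ∫⁻ ω, ENNReal.ofReal (Real.exp (-(x * (1 + ∑ j ∈ s, d j * e j ω)))) ∂μ =
      ENNReal.ofReal ((Real.exp x * ∏ j ∈ s, (1 + d j * x))⁻¹) := by
  have h1 : ∀ ω, ENNReal.ofReal (Real.exp (-(x * (1 + ∑ j ∈ s, d j * e j ω)))) =
      ENNReal.ofReal (Real.exp (-x)) *
        ∏ j ∈ s, ENNReal.ofReal (Real.exp (-(d j * x * e j ω))) := fun ω => by
    rw [← ENNReal.ofReal_prod_of_nonneg fun _ _ => (Real.exp_pos _).le,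
      ← ENNReal.ofReal_mul (Real.exp_pos _).le, ← Real.exp_sum, ← Real.exp_add]
    congr 2
    rw [mul_add, mul_one, neg_add, Finset.sum_neg_distrib, Finset.mul_sum]
    congr 2
    exact Finset.sum_congr rfl fun j _ => by ring
  simp only [h1]
  rw [lintegral_const_mul _ (by fun_prop), lintegral_prod_eq_prod_lintegral_of_indepFun s
    (fun j ω => ENNReal.ofReal (Real.exp (-(d j * x * e j ω))))
    (hind.comp (fun j y => ENNReal.ofReal (Real.exp (-(d j * x * y)))) fun j => by fun_prop)
    (fun j => by fun_prop), mul_inv, ENNReal.ofReal_mul (by positivity), ← Real.exp_neg,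
    ← Finset.prod_inv_distrib, ENNReal.ofReal_prod_of_nonneg]
  · congr 1
    refine Finset.prod_congr rfl fun j hj => ?_
    rw [← lintegral_unitExponential_exp_neg_mul (mul_nonneg (hd j hj) hx), ← hlaw j,
      lintegral_map (by fun_prop) (hm j)]
  · intro j hj
    have := mul_nonneg (hd j hj) hx
    positivity

lemma lintegral_interference_prod (hind : iIndepFun e μ) (hm : ∀ j, Measurable (e j))
    (hlaw : ∀ j, μ.map (e j) = unitExponential) (s : Finset ι) (i : ι) (hi : i ∉ s) (d : ι → ℝ)
    {F : ℝ → ℝ → ENNReal} (hF : Measurable (Function.uncurry F)) :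
    ∫⁻ ω, F (1 + ∑ j ∈ s, d j * e j ω) (e i ω) ∂μ =
      ∫⁻ ω, ∫⁻ y, F (1 + ∑ j ∈ s, d j * e j ω) y ∂unitExponential ∂μ := by
  have := hind.isProbabilityMeasure
  have hp : IsProbabilityMeasure unitExponential :=
    hlaw i ▸ Measure.isProbabilityMeasure_map (hm i).aemeasurable
  have hW : Measurable fun ω => 1 + ∑ j ∈ s, d j * e j ω := by fun_prop
  have h1 := (indepFun_iff_map_prod_eq_prod_map_map hW.aemeasurable (hm i).aemeasurable).1
    (indepFun_interference hind hm s i hi d)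
  calc _ = ∫⁻ z, Function.uncurry F z ∂(μ.map fun ω => (1 + ∑ j ∈ s, d j * e j ω, e i ω)) := by
        rw [lintegral_map hF (hW.prodMk (hm i))]; rfl
    _ = _ := by
        rw [h1, hlaw i, lintegral_prod _ hF.aemeasurable, lintegral_map _ hW]
        · rfl
        · exact Measurable.lintegral_prod_right hF

/-- The probability that an exponential variable exceeds `x` times the interference. -/
lemma measure_mul_interference_le (hind : iIndepFun e μ) (hm : ∀ j, Measurable (e j))
    (hlaw : ∀ j, μ.map (e j) = unitExponential) (hpos : ∀ j ω, 0 ≤ e j ω) (s : Finset ι) (i : ι)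
    (hi : i ∉ s) (d : ι → ℝ) (hd : ∀ j ∈ s, 0 ≤ d j) {x : ℝ} (hx : 0 ≤ x) :
    μ {ω | x * (1 + ∑ j ∈ s, d j * e j ω) ≤ e i ω} =
      ENNReal.ofReal ((Real.exp x * ∏ j ∈ s, (1 + d j * x))⁻¹) := by
  have hset : MeasurableSet {z : ℝ × ℝ | x * z.1 ≤ z.2} :=
    measurableSet_le (by fun_prop) (by fun_prop)
  have h1 := lintegral_interference_prod hind hm hlaw s i hi d
    (F := fun w y => Set.indicator {z : ℝ × ℝ | x * z.1 ≤ z.2} 1 (w, y))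
    (measurable_one.indicator hset)
  have h2 : ∀ ω, (∫⁻ y, Set.indicator {z : ℝ × ℝ | x * z.1 ≤ z.2} 1
      (1 + ∑ j ∈ s, d j * e j ω, y) ∂unitExponential) =
        ENNReal.ofReal (Real.exp (-(x * (1 + ∑ j ∈ s, d j * e j ω)))) := fun ω => by
    have h3 : 0 ≤ ∑ j ∈ s, d j * e j ω :=
      Finset.sum_nonneg fun j hj => mul_nonneg (hd j hj) (hpos j ω)
    rw [← unitExponential_Ici (by positivity), ← lintegral_indicator_one measurableSet_Ici]
    rfl
  simp only [h2] at h1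
  rw [lintegral_exp_neg_interference hind hm hlaw s d hd hx] at h1
  rw [← h1, ← lintegral_indicator_one (measurableSet_le (by fun_prop) (hm i))]
  rfl

/-- The mean excess of the quotient of an exponential variable and the interference. -/
lemma lintegral_div_interference_sub_le (hind : iIndepFun e μ) (hm : ∀ j, Measurable (e j))
    (hlaw : ∀ j, μ.map (e j) = unitExponential) (hpos : ∀ j ω, 0 ≤ e j ω) (s : Finset ι) (i : ι)
    (hi : i ∉ s) (d : ι → ℝ) (hd : ∀ j ∈ s, 0 ≤ d j) {x : ℝ} (hx : 0 ≤ x) :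
    ∫⁻ ω, ENNReal.ofReal (e i ω / (1 + ∑ j ∈ s, d j * e j ω) - x) ∂μ ≤
      ENNReal.ofReal ((Real.exp x * ∏ j ∈ s, (1 + d j * x))⁻¹) := by
  rw [← lintegral_exp_neg_interference hind hm hlaw s d hd hx]
  have h3 : ∀ ω, 0 ≤ ∑ j ∈ s, d j * e j ω := fun ω =>
    Finset.sum_nonneg fun j hj => mul_nonneg (hd j hj) (hpos j ω)
  -- Multiplying a positive excess by the interference plus noise, which is at least one, only
  -- enlarges it.
  calc _ ≤ ∫⁻ ω, ENNReal.ofReal (e i ω - x * (1 + ∑ j ∈ s, d j * e j ω)) ∂μ := by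
        refine lintegral_mono fun ω => ?_
        set W := 1 + ∑ j ∈ s, d j * e j ω with hW
        have hW1 : 1 ≤ W := by linarith [h3 ω]
        by_cases h : e i ω / W ≤ x
        · rw [ENNReal.ofReal_of_nonpos (by linarith)]; exact zero_le
        · push Not at h
          refine ENNReal.ofReal_le_ofReal ?_
          have h4 : e i ω - x * W = (e i ω / W - x) * W := by field_simp
          rw [h4]
          exact le_mul_of_one_le_right (by linarith) hW1
    _ = _ := by
        rw [lintegral_interference_prod hind hm hlaw s i hi d
          (F := fun w y => ENNReal.ofReal (y - x * w)) (by
            unfold Function.uncurry; fun_prop)]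
        refine lintegral_congr fun ω => ?_
        rw [lintegral_unitExponential_sub (mul_nonneg hx (by linarith [h3 ω]))]

end Interference

/-! ### Geometry of the cells and the law of a single user. -/

namespace HexNetwork

instance isProbabilityMeasure_complexGaussian : IsProbabilityMeasure complexGaussian :=
  Measure.isProbabilityMeasure_map
    (Complex.measurableEquivRealProd.symm.measurable : Measurable fun z : ℝ × ℝ => (⟨z.1, z.2⟩ : ℂ)).aemeasurable

lemma integrable_norm_sq_complexGaussian :
    Integrable (fun z : ℂ => ‖z‖ ^ 2) complexGaussian := by
  refine (lintegral_ofReal_ne_top_iff_integrable (by fun_prop) (ae_of_all _ fun z => by positivity)).1 ?_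
  rw [lintegral_complexGaussian_norm_sq (fun s => ENNReal.ofReal s) (by fun_prop)]
  have := lintegral_unitExponential_sub le_rfl
  simp only [sub_zero] at this
  simp [this]

lemma dist_sq_plane (z a : Plane) : dist z a ^ 2 = (z 0 - a 0) ^ 2 + (z 1 - a 1) ^ 2 := by
  rw [EuclideanSpace.dist_eq, Real.sq_sqrt (by positivity), Fin.sum_univ_two, Real.dist_eq,
    Real.dist_eq, sq_abs, sq_abs]

lemma hexagon_subset_closedBall {R : ℝ} (hR : 0 ≤ R) (a : Plane) :
    hexagon R a ⊆ Metric.closedBall a (3 * R) := by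
  rintro z ⟨h0, h1, h2⟩
  rw [Metric.mem_closedBall]
  refine le_of_sq_le_sq ?_ (by positivity)
  rw [dist_sq_plane]
  set x := z 0 - a 0
  set y := z 1 - a 1
  rw [abs_le] at h0 h1 h2
  -- `√3 * y` is the sum of the two oblique coordinates. The radius `3 * R` is not sharp; only
  -- boundedness matters.
  have h3 : (Real.sqrt 3 * y) ^ 2 ≤ (2 * R) ^ 2 := by
    refine sq_le_sq' ?_ ?_ <;> linarith
  have h4 : (Real.sqrt 3 * y) ^ 2 = 3 * y ^ 2 := by
    rw [mul_pow, Real.sq_sqrt (by norm_num)]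
  nlinarith

lemma ball_subset_hexagon {R : ℝ} (a : Plane) :
    Metric.ball a R ⊆ hexagon R a := by
  intro z hz
  have hd : dist z a < R := hz
  have hR : 0 ≤ R := dist_nonneg.trans hd.le
  have hsq : dist z a ^ 2 ≤ R ^ 2 := pow_le_pow_left₀ dist_nonneg hd.le 2
  rw [dist_sq_plane] at hsq
  have h3 : Real.sqrt 3 ^ 2 = 3 := Real.sq_sqrt (by norm_num)
  refine ⟨abs_le_of_sq_le_sq ?_ hR, abs_le_of_sq_le_sq ?_ hR, abs_le_of_sq_le_sq ?_ hR⟩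
  · nlinarith [sq_nonneg (z 1 - a 1)]
  -- Rotated coordinates: `(x / 2 + √3 / 2 * y) ^ 2 + (√3 * x - y) ^ 2 / 4 = x ^ 2 + y ^ 2`.
  · nlinarith [sq_nonneg (Real.sqrt 3 * (z 0 - a 0) - (z 1 - a 1))]
  · nlinarith [sq_nonneg (Real.sqrt 3 * (z 0 - a 0) + (z 1 - a 1))]

lemma isClosed_hexagon (R : ℝ) (a : Plane) : IsClosed (hexagon R a) := by
  unfold hexagon
  refine IsClosed.and (isClosed_le (by fun_prop) continuous_const)
    (IsClosed.and (isClosed_le (by fun_prop) continuous_const)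
      (isClosed_le (by fun_prop) continuous_const))

variable {B N : ℕ} (S : HexNetwork B N)

lemma R_pos : 0 < S.R := S.r₀_pos.trans S.r₀_lt_R

lemma volume_cell_ne_top (i : Fin B) : volume (S.cell i) ≠ ⊤ :=
  ((measure_mono (hexagon_subset_closedBall S.R_pos.le _)).trans_lt
    measure_closedBall_lt_top).ne

lemma volume_cell_ne_zero (i : Fin B) : volume (S.cell i) ≠ 0 :=
  ((Metric.measure_ball_pos volume _ S.R_pos).trans_le
    (measure_mono (ball_subset_hexagon _))).ne'

lemma measurableSet_cell (i : Fin B) : MeasurableSet (S.cell i) :=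
  (isClosed_hexagon _ _).measurableSet

instance isProbabilityMeasure_uniform_cell (i : Fin B) :
    IsProbabilityMeasure (cond volume (S.cell i)) :=
  cond_isProbabilityMeasure_of_finite (S.volume_cell_ne_zero i) (S.volume_cell_ne_top i)

instance isProbabilityMeasure_law (ρ : ℕ) : IsProbabilityMeasure (S.law ρ) := by
  unfold law; infer_instance

/-- The joint law of the position of a user in the cell of transmitter `i` and of its fading
factors over a resource block. -/
noncomputable def userLaw (i : Fin B) : Measure (Plane × (Fin B → ℂ)) :=
  (cond volume (S.cell i)).prod (Measure.pi fun _ => complexGaussian)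

instance isProbabilityMeasure_userLaw (i : Fin B) : IsProbabilityMeasure (S.userLaw i) := by
  unfold userLaw; infer_instance

/-- The positions of the users of transmitter `i` and their fading factors over block `n`. -/
def cellData {ρ : ℕ} (i : Fin B) (n : Fin N) (ω : Sample B N ρ) (k : Fin ρ) :
    Plane × (Fin B → ℂ) :=
  (ω.1 (i, k), fun j => ω.2 (j, (i, k), n))

lemma measurable_cellData {ρ : ℕ} (i : Fin B) (n : Fin N) :
    Measurable (cellData (ρ := ρ) i n) := by
  unfold cellData; fun_prop

lemma map_pi_comp_of_injective {α ι X : Type*} [Fintype α] [Fintype ι] [MeasurableSpace X]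
    (P : ι → Measure X) [∀ i, IsProbabilityMeasure (P i)] {f : α → ι} (hf : Function.Injective f) :
    (Measure.pi P).map (fun ω a => ω (f a)) = Measure.pi fun a => P (f a) := by
  rw [← Measure.infinitePi_eq_pi, ← Measure.infinitePi_eq_pi]
  exact Measure.map_infinitePi_infinitePi_of_inj (P := P) hf

lemma map_pi_curry {α γ X : Type*} [Fintype α] [Fintype γ] [MeasurableSpace X]
    (P : Measure X) [IsProbabilityMeasure P] :
    (Measure.pi fun _ : α × γ => P).map (fun ω a c => ω (a, c)) =
      Measure.pi fun _ : α => Measure.pi fun _ : γ => P := by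
  simp only [← Measure.infinitePi_eq_pi]
  exact Measure.infinitePi_map_curry (fun _ _ => P)

/-- For fixed `i` and `n` the users are i.i.d. The dependence between different pairs `(i, n)` never
matters, as the expectation of the sum splits. -/
lemma map_cellData (ρ : ℕ) (i : Fin B) (n : Fin N) :
    (S.law ρ).map (cellData i n) = Measure.pi fun _ => S.userLaw i := by
  have h1 : (Measure.pi fun k : Fin B × Fin ρ => cond volume (S.cell k.1)).map
      (fun p (k : Fin ρ) => p (i, k)) = Measure.pi fun _ => cond volume (S.cell i) :=
    map_pi_comp_of_injective (fun k : Fin B × Fin ρ => cond volume (S.cell k.1))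
      (f := fun k => (i, k)) fun a b h => by simpa using h
  have h2 : (Measure.pi fun _ : Fin B × (Fin B × Fin ρ) × Fin N => complexGaussian).map
      (fun f (k : Fin ρ) (j : Fin B) => f (j, (i, k), n)) =
        Measure.pi fun _ => Measure.pi fun _ => complexGaussian := by
    rw [← map_pi_curry, ← map_pi_comp_of_injective
      (fun _ : Fin B × (Fin B × Fin ρ) × Fin N => complexGaussian)
      (f := fun c : Fin ρ × Fin B => (c.2, (i, c.1), n)) (fun a b h => by
        simp only [Prod.mk.injEq, true_and, and_true] at h
        exact Prod.ext h.2 h.1),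
      Measure.map_map (by fun_prop) (by fun_prop)]
    rfl
  have h3 := (measurePreserving_arrowProdEquivProdArrow Plane (Fin B → ℂ) (Fin ρ)
    (fun _ => cond volume (S.cell i)) (fun _ => Measure.pi fun _ => complexGaussian)).symm.map_eq
  unfold userLaw
  rw [← h3, ← h1, ← h2, Measure.map_prod_map _ _ (by fun_prop) (by fun_prop),
    Measure.map_map (MeasurableEquiv.measurable _) (by fun_prop)]
  rfl

/-- The signal-to-noise ratio between transmitter `j` and a user with given position and fading. -/
noncomputable def userSnr (j : Fin B) (y : Plane × (Fin B → ℂ)) : ℝ :=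
  (S.β * max S.r₀ (dist y.1 (S.tx j)) ^ (-S.α)) ^ 2 * ‖y.2 j‖ ^ 2

/-- The ratio of the signal-to-noise ratio to interference plus noise. -/
noncomputable def userSinr (q : Fin B → Fin N → ℝ) (i : Fin B) (n : Fin N)
    (y : Plane × (Fin B → ℂ)) : ℝ :=
  S.userSnr i y / (1 + ∑ j ∈ Finset.univ.erase i, S.userSnr j y * q j n)

lemma snr_eq_userSnr {ρ : ℕ} (ω : Sample B N ρ) (i j : Fin B) (k : Fin ρ) (n : Fin N) :
    S.snr ω j (i, k) n = S.userSnr j (cellData i n ω k) := by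
  simp only [snr, gain, userSnr, cellData, truncDist, norm_mul, mul_pow, Complex.norm_real,
    Real.norm_eq_abs, sq_abs]

lemma sumRate_eq {ρ : ℕ} (q : Fin B → Fin N → ℝ) (u : Fin B → Fin N → Fin ρ)
    (ω : Sample B N ρ) :
    S.sumRate q u ω =
      ∑ i, ∑ n, Real.log (1 + q i n * S.userSinr q i n (cellData i n ω (u i n))) := by
  unfold sumRate userSinr
  simp only [S.snr_eq_userSnr]
  refine Finset.sum_congr rfl fun i _ => Finset.sum_congr rfl fun n _ => ?_
  congr 2
  ring

/-- For fixed powers the choice `u i n` enters only the term `(i, n)`, so the maximum of the sum is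
the sum of the maxima. -/
lemma bestSumRate_eq {ρ : ℕ} [NeZero ρ] (q : Fin B → Fin N → ℝ) (ω : Sample B N ρ) :
    S.bestSumRate q ω =
      ∑ i, ∑ n, ⨆ k, Real.log (1 + q i n * S.userSinr q i n (cellData i n ω k)) := by
  unfold bestSumRate
  apply le_antisymm
  · refine ciSup_le fun u => ?_
    rw [S.sumRate_eq]
    exact Finset.sum_le_sum fun i _ => Finset.sum_le_sum fun n _ =>
      le_ciSup (f := fun k => Real.log (1 + q i n * S.userSinr q i n (cellData i n ω k)))
        (Set.finite_range _).bddAbove (u i n)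
  · have h : ∀ i n, ∃ k, Real.log (1 + q i n * S.userSinr q i n (cellData i n ω k)) =
        ⨆ k, Real.log (1 + q i n * S.userSinr q i n (cellData i n ω k)) := fun i n =>
      exists_eq_ciSup_of_finite
    choose u hu using h
    simp only [← hu]
    rw [← S.sumRate_eq]
    exact le_ciSup (f := fun u => S.sumRate q u ω) (Set.finite_range _).bddAbove u

lemma measurable_userSnr (j : Fin B) : Measurable (S.userSnr j) := by
  unfold userSnr; fun_prop

lemma userSnr_nonneg (j : Fin B) (y : Plane × (Fin B → ℂ)) : 0 ≤ S.userSnr j y := by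
  unfold userSnr; positivity

lemma measurable_userSinr (q : Fin B → Fin N → ℝ) (i : Fin B) (n : Fin N) :
    Measurable (S.userSinr q i n) := by
  have := S.measurable_userSnr
  unfold userSinr; fun_prop

lemma sq_mul_rpow_neg (d : ℝ) (hd : 0 < d) :
    (S.β * d ^ (-S.α)) ^ 2 = S.β ^ 2 * d ^ (-2 * S.α) := by
  rw [mul_pow, ← Real.rpow_natCast (d ^ (-S.α)), ← Real.rpow_mul hd.le]
  congr 2
  push_cast
  ring

lemma userSnr_le (j : Fin B) (y : Plane × (Fin B → ℂ)) :
    S.userSnr j y ≤ S.peakGain * ‖y.2 j‖ ^ 2 := by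
  have h0 := S.r₀_pos
  have h1 : 0 < max S.r₀ (dist y.1 (S.tx j)) := lt_max_of_lt_left h0
  have := S.one_lt_α
  unfold userSnr peakGain
  rw [S.sq_mul_rpow_neg _ h1]
  refine mul_le_mul_of_nonneg_right (mul_le_mul_of_nonneg_left ?_ (sq_nonneg _)) (sq_nonneg _)
  exact Real.rpow_le_rpow_of_nonpos h0 (le_max_left _ _) (by linarith)

lemma userSnr_eq_of_mem_ball {i : Fin B} {y : Plane × (Fin B → ℂ)}
    (hy : y.1 ∈ Metric.ball (S.tx i) S.r₀) : S.userSnr i y = S.peakGain * ‖y.2 i‖ ^ 2 := by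
  unfold userSnr peakGain
  rw [max_eq_left (le_of_lt hy), S.sq_mul_rpow_neg _ S.r₀_pos]

/-- There are finitely many bounded cells, so the distances between users and transmitters are
bounded, and interfering gains cannot be arbitrarily weak. -/
lemma exists_le_userSnr : ∃ b, 0 < b ∧ ∀ (i j : Fin B) (y : Plane × (Fin B → ℂ)),
    y.1 ∈ S.cell i → b * ‖y.2 j‖ ^ 2 ≤ S.userSnr j y := by
  have h0 := S.r₀_pos
  have hR := S.R_pos
  have hα := S.one_lt_α
  have hβ := S.β_pos
  let D := S.r₀ + 3 * S.R + ∑ i, ∑ j, dist (S.tx i) (S.tx j)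
  have hsum : 0 ≤ ∑ i, ∑ j, dist (S.tx i) (S.tx j) :=
    Finset.sum_nonneg fun i _ => Finset.sum_nonneg fun j _ => dist_nonneg
  have hD : 0 < D := by positivity
  refine ⟨S.β ^ 2 * D ^ (-2 * S.α), by positivity, fun i j y hy => ?_⟩
  have h1 : 0 < max S.r₀ (dist y.1 (S.tx j)) := lt_max_of_lt_left h0
  unfold userSnr
  rw [S.sq_mul_rpow_neg _ h1]
  refine mul_le_mul_of_nonneg_right (mul_le_mul_of_nonneg_left ?_ (sq_nonneg _)) (sq_nonneg _)
  refine Real.rpow_le_rpow_of_nonpos h1 (max_le ?_ ?_) (by linarith)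
  · show S.r₀ ≤ S.r₀ + 3 * S.R + _
    linarith
  · have h2 : dist y.1 (S.tx i) ≤ 3 * S.R := hexagon_subset_closedBall hR.le _ hy
    have h3 : dist (S.tx i) (S.tx j) ≤ ∑ i, ∑ j, dist (S.tx i) (S.tx j) :=
      (Finset.single_le_sum (f := fun j => dist (S.tx i) (S.tx j)) (fun j _ => dist_nonneg)
        (Finset.mem_univ j)).trans
      (Finset.single_le_sum (f := fun i => ∑ j, dist (S.tx i) (S.tx j))
        (fun i _ => Finset.sum_nonneg fun j _ => dist_nonneg) (Finset.mem_univ i))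
    show _ ≤ S.r₀ + 3 * S.R + _
    linarith [dist_triangle y.1 (S.tx i) (S.tx j)]

lemma userSinr_nonneg {q : Fin B → Fin N → ℝ} (hq : q ∈ S.powers) (i : Fin B) (n : Fin N)
    (y : Plane × (Fin B → ℂ)) : 0 ≤ S.userSinr q i n y :=
  div_nonneg (S.userSnr_nonneg i y) (add_nonneg zero_le_one (Finset.sum_nonneg fun j _ =>
    mul_nonneg (S.userSnr_nonneg j y) (hq.1 j n)))

lemma one_le_interference {q : Fin B → Fin N → ℝ} (hq : q ∈ S.powers) (i : Fin B) (n : Fin N)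
    (y : Plane × (Fin B → ℂ)) :
    1 ≤ 1 + ∑ j ∈ Finset.univ.erase i, S.userSnr j y * q j n :=
  le_add_of_nonneg_right (Finset.sum_nonneg fun j _ =>
    mul_nonneg (S.userSnr_nonneg j y) (hq.1 j n))

lemma userSinr_le {q : Fin B → Fin N → ℝ} (hq : q ∈ S.powers) (i : Fin B) (n : Fin N)
    (y : Plane × (Fin B → ℂ)) : S.userSinr q i n y ≤ S.peakGain * ‖y.2 i‖ ^ 2 :=
  (div_le_self (S.userSnr_nonneg i y) (S.one_le_interference hq i n y)).trans (S.userSnr_le i y)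

lemma iIndepFun_norm_sq :
    iIndepFun (fun (j : Fin B) (ν : Fin B → ℂ) => ‖ν j‖ ^ 2)
      (Measure.pi fun _ => complexGaussian) :=
  iIndepFun_pi (X := fun _ z => ‖z‖ ^ 2) fun _ => by fun_prop

lemma map_norm_sq_pi (j : Fin B) :
    (Measure.pi fun _ : Fin B => complexGaussian).map (fun ν => ‖ν j‖ ^ 2) =
      unitExponential := by
  have h := (measurePreserving_eval (fun _ : Fin B => complexGaussian) j).map_eq
  rw [← map_norm_sq_complexGaussian, ← h, Measure.map_map (by fun_prop) (by fun_prop), h]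
  rfl

/-- Translates the interference formulas, normalised to a unit-mean signal at level `t / a` and
interferers of mean gain `b`, into `levelCurve` with attenuation `a / b`. -/
lemma levelCurve_eq (a b : ℝ) (hab : S.peakGain = a) (q : Fin B → Fin N → ℝ)
    (i : Fin B) (n : Fin N) (t : ℝ) :
    S.levelCurve (a / b) q i n t =
      Real.exp (t / a) * ∏ j ∈ Finset.univ.erase i, (1 + b * q j n * (t / a)) := by
  have ha : 0 < a := hab ▸ S.peakGain_pos
  unfold levelCurve
  rw [hab]
  congr 1
  refine Finset.prod_congr rfl fun j _ => ?_
  field_simp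

/-- The mean excess over the level `t` of the ratio of a user. -/
lemma exists_lintegral_userSinr_sub_le : ∃ M, 0 < M ∧ ∀ q ∈ S.powers, ∀ i n t, 0 < t →
    ∫⁻ y, ENNReal.ofReal (S.userSinr q i n y - t) ∂(S.userLaw i) ≤
      ENNReal.ofReal (S.peakGain / S.levelCurve M q i n t) := by
  obtain ⟨b, hb, hle⟩ := S.exists_le_userSnr
  have ha := S.peakGain_pos
  -- The excess grows if the own gain is raised to its peak and every interfering gain is lowered to
  -- `b`.
  refine ⟨S.peakGain / b, by positivity, fun q hq i n t ht => ?_⟩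
  set a := S.peakGain with hadef
  have hae : ∀ᵐ y ∂(S.userLaw i), y.1 ∈ S.cell i := by
    have h1 : ∀ᵐ z ∂(cond volume (S.cell i)), z ∈ S.cell i :=
      ae_cond_mem (S.measurableSet_cell i)
    exact Measure.quasiMeasurePreserving_fst.ae h1
  calc _ ≤ ∫⁻ y : Plane × (Fin B → ℂ), ENNReal.ofReal a * ENNReal.ofReal (‖y.2 i‖ ^ 2 /
        (1 + ∑ j ∈ Finset.univ.erase i, b * q j n * ‖y.2 j‖ ^ 2) - t / a) ∂(S.userLaw i) := by
        refine lintegral_mono_ae ?_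
        filter_upwards [hae] with y hy
        rw [← ENNReal.ofReal_mul ha.le]
        refine ENNReal.ofReal_le_ofReal ?_
        rw [mul_sub, mul_div_cancel₀ _ ha.ne', ← mul_div_assoc]
        gcongr ?_ - t
        have h2 : 0 ≤ ∑ j ∈ Finset.univ.erase i, b * q j n * ‖y.2 j‖ ^ 2 :=
          Finset.sum_nonneg fun j _ => by have := hq.1 j n; positivity
        refine div_le_div₀ (by positivity) (S.userSnr_le i y) (by positivity) ?_
        gcongr 1 + ?_
        refine Finset.sum_le_sum fun j _ => ?_
        have := mul_le_mul_of_nonneg_right (hle i j y hy) (hq.1 j n)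
        linarith
    _ = ENNReal.ofReal a * ∫⁻ ν : Fin B → ℂ, ENNReal.ofReal (‖ν i‖ ^ 2 /
        (1 + ∑ j ∈ Finset.univ.erase i, b * q j n * ‖ν j‖ ^ 2) - t / a)
          ∂(Measure.pi fun _ => complexGaussian) := by
        rw [lintegral_const_mul _ (by fun_prop), userLaw]
        congr 1
        rw [lintegral_prod _ (by fun_prop)]
        simp
    _ ≤ ENNReal.ofReal a * ENNReal.ofReal
          ((Real.exp (t / a) * ∏ j ∈ Finset.univ.erase i, (1 + b * q j n * (t / a)))⁻¹) := by
        gcongr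
        exact lintegral_div_interference_sub_le iIndepFun_norm_sq (fun j => by fun_prop)
          map_norm_sq_pi (fun j ν => by positivity) (Finset.univ.erase i) i (by simp)
          (fun j => b * q j n) (fun j _ => by have := hq.1 j n; positivity) (by positivity)
    _ = _ := by
        rw [S.levelCurve_eq a b rfl, ← ENNReal.ofReal_mul ha.le]
        rfl

/-- The probability that the ratio of a user exceeds the level `t`. -/
lemma exists_le_userLaw_userSinr : ∃ c₀, 0 < c₀ ∧ ∀ q ∈ S.powers, ∀ i n t, 0 ≤ t →
    c₀ / S.levelCurve 1 q i n t ≤ (S.userLaw i).real {y | t ≤ S.userSinr q i n y} := by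
  have ha := S.peakGain_pos
  have hr := S.r₀_pos
  have hR := S.R_pos
  -- A lower bound for the probability that a user lies within the truncation radius, where the own
  -- gain is exactly the peak; interfering gains are never above the peak.
  set c₀ : ENNReal := (volume (Metric.closedBall (0 : Plane) (3 * S.R)))⁻¹ *
    volume (Metric.ball (0 : Plane) S.r₀) with hc₀
  have hc_pos : c₀ ≠ 0 := mul_ne_zero (ENNReal.inv_ne_zero.2 measure_closedBall_lt_top.ne)
    (Metric.measure_ball_pos _ _ hr).ne'
  have hc_top : c₀ ≠ ⊤ := ENNReal.mul_ne_top (ENNReal.inv_ne_top.2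
    (Metric.measure_closedBall_pos _ _ (by positivity)).ne') measure_ball_lt_top.ne
  refine ⟨c₀.toReal, ENNReal.toReal_pos hc_pos hc_top, fun q hq i n t ht => ?_⟩
  set a := S.peakGain with hadef
  have hball : c₀ ≤ cond volume (S.cell i) (Metric.ball (S.tx i) S.r₀) := by
    have hin : Metric.ball (S.tx i) S.r₀ ⊆ S.cell i :=
      (Metric.ball_subset_ball S.r₀_lt_R.le).trans (ball_subset_hexagon _)
    rw [cond_apply (S.measurableSet_cell i), Set.inter_eq_right.2 hin, hc₀,
      ← Measure.addHaar_closedBall_center volume (S.tx i),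
      ← Measure.addHaar_ball_center volume (S.tx i)]
    gcongr
    exact hexagon_subset_closedBall hR.le _
  have hsub : Metric.ball (S.tx i) S.r₀ ×ˢ {ν : Fin B → ℂ |
      t / a * (1 + ∑ j ∈ Finset.univ.erase i, a * q j n * ‖ν j‖ ^ 2) ≤ ‖ν i‖ ^ 2} ⊆
        {y | t ≤ S.userSinr q i n y} := by
    rintro ⟨z, ν⟩ ⟨hz, hν⟩
    simp only [Set.mem_ofPred_eq] at hν ⊢
    have h1 := S.one_le_interference hq i n (z, ν)
    rw [userSinr, le_div_iff₀ (by linarith), S.userSnr_eq_of_mem_ball hz]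
    have h2 : ∑ j ∈ Finset.univ.erase i, S.userSnr j (z, ν) * q j n ≤
        ∑ j ∈ Finset.univ.erase i, a * q j n * ‖ν j‖ ^ 2 := by
      refine Finset.sum_le_sum fun j _ => ?_
      have := mul_le_mul_of_nonneg_right (S.userSnr_le j (z, ν)) (hq.1 j n)
      rw [← hadef] at this
      simp only at this
      linarith
    rw [div_mul_eq_mul_div, div_le_iff₀' ha] at hν
    refine le_trans ?_ hν
    gcongr
  have h3 := measure_mul_interference_le iIndepFun_norm_sq (fun j => by fun_prop)
    map_norm_sq_pi (fun j ν => by positivity) (Finset.univ.erase i) i (by simp)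
    (fun j => a * q j n) (fun j _ => by have := hq.1 j n; positivity)
    (show 0 ≤ t / a by positivity)
  have h4 := S.levelCurve_eq a a rfl q i n t
  rw [div_self ha.ne'] at h4
  rw [← h4] at h3
  have hlc := S.levelCurve_pos one_pos hq i n ht
  refine (ENNReal.ofReal_le_iff_le_toReal (measure_ne_top _ _)).1 ?_
  calc _ = c₀ * ENNReal.ofReal ((S.levelCurve 1 q i n t)⁻¹) := by
        rw [div_eq_mul_inv, ENNReal.ofReal_mul ENNReal.toReal_nonneg, ENNReal.ofReal_toReal hc_top]
    _ ≤ S.userLaw i (Metric.ball (S.tx i) S.r₀ ×ˢ {ν : Fin B → ℂ |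
      t / a * (1 + ∑ j ∈ Finset.univ.erase i, a * q j n * ‖ν j‖ ^ 2) ≤ ‖ν i‖ ^ 2}) := by
        rw [userLaw, Measure.prod_prod, ← h3]
        gcongr
    _ ≤ _ := measure_mono hsub

end HexNetwork

/-! ### Expected best rates. -/

namespace HexNetwork

variable {B N : ℕ} (S : HexNetwork B N)

/-- The largest rate of a user of transmitter `i` over resource block `n`. -/
noncomputable def bestRate {ρ : ℕ} (q : Fin B → Fin N → ℝ) (i : Fin B) (n : Fin N)
    (ω : Sample B N ρ) : ℝ :=
  ⨆ k, Real.log (1 + q i n * S.userSinr q i n (cellData i n ω k))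

lemma measurable_bestRate {ρ : ℕ} (q : Fin B → Fin N → ℝ) (i : Fin B) (n : Fin N) :
    Measurable (S.bestRate (ρ := ρ) q i n) := by
  refine Measurable.iSup fun k => ?_
  have h1 := S.measurable_userSinr q i n
  have h2 : Measurable fun ω : Sample B N ρ => cellData i n ω k :=
    (measurable_pi_apply k).comp (measurable_cellData i n)
  exact Real.measurable_log.comp (((h1.comp h2).const_mul _).const_add _)

lemma integrable_norm_sq_fading (ρ : ℕ) (c : Fin B × (Fin B × Fin ρ) × Fin N) :
    Integrable (fun ω : Sample B N ρ => ‖ω.2 c‖ ^ 2) (S.law ρ) :=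
  ((measurePreserving_eval (fun _ : Fin B × (Fin B × Fin ρ) × Fin N => complexGaussian) c).comp
    measurePreserving_snd).integrable_comp_of_integrable integrable_norm_sq_complexGaussian

lemma log_one_add_userSinr_nonneg {q : Fin B → Fin N → ℝ} (hq : q ∈ S.powers) (i : Fin B)
    (n : Fin N) (y : Plane × (Fin B → ℂ)) : 0 ≤ Real.log (1 + q i n * S.userSinr q i n y) :=
  Real.log_nonneg (le_add_of_nonneg_right (mul_nonneg (hq.1 i n) (S.userSinr_nonneg hq i n y)))

lemma bestRate_nonneg {ρ : ℕ} [NeZero ρ] {q : Fin B → Fin N → ℝ} (hq : q ∈ S.powers) (i : Fin B)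
    (n : Fin N) (ω : Sample B N ρ) : 0 ≤ S.bestRate q i n ω :=
  (S.log_one_add_userSinr_nonneg hq i n (cellData i n ω 0)).trans
    (le_ciSup (f := fun k => Real.log (1 + q i n * S.userSinr q i n (cellData i n ω k)))
      (Set.finite_range _).bddAbove 0)

/-- The bound does not depend on `q`, so it serves both for integrability and as the dominating
function for continuity in `q`. -/
lemma bestRate_le {ρ : ℕ} [NeZero ρ] {q : Fin B → Fin N → ℝ} (hq : q ∈ S.powers) (i : Fin B)
    (n : Fin N) (ω : Sample B N ρ) :
    S.bestRate q i n ω ≤ ∑ k, S.Pcon * (S.peakGain * ‖ω.2 (i, (i, k), n)‖ ^ 2) := by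
  have hP := S.Pcon_pos
  have ha := S.peakGain_pos
  refine ciSup_le fun k => ?_
  have h1 := S.userSinr_nonneg hq i n (cellData i n ω k)
  have h2 := S.userSinr_le hq i n (cellData i n ω k)
  have h3 := hq.1 i n
  have h4 : 0 ≤ q i n * S.userSinr q i n (cellData i n ω k) := mul_nonneg h3 h1
  calc _ ≤ q i n * S.userSinr q i n (cellData i n ω k) := by
        have := Real.log_le_sub_one_of_pos (show 0 < 1 + q i n * S.userSinr q i n (cellData i n ω k)
          by linarith)
        linarith
    _ ≤ S.Pcon * (S.peakGain * ‖ω.2 (i, (i, k), n)‖ ^ 2) :=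
        mul_le_mul (S.powers_le hq i n) h2 h1 hP.le
    _ ≤ _ := Finset.single_le_sum (f := fun k => S.Pcon * (S.peakGain * ‖ω.2 (i, (i, k), n)‖ ^ 2))
        (fun k _ => by positivity) (Finset.mem_univ k)

lemma integrable_rate_bound (ρ : ℕ) (i : Fin B) (n : Fin N) :
    Integrable (fun ω : Sample B N ρ =>
      ∑ k, S.Pcon * (S.peakGain * ‖ω.2 (i, (i, k), n)‖ ^ 2)) (S.law ρ) :=
  integrable_finsetSum _ fun k _ =>
    ((S.integrable_norm_sq_fading ρ (i, (i, k), n)).const_mul _).const_mul _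

lemma integrable_bestRate {ρ : ℕ} [NeZero ρ] {q : Fin B → Fin N → ℝ} (hq : q ∈ S.powers)
    (i : Fin B) (n : Fin N) : Integrable (S.bestRate q i n) (S.law ρ) := by
  refine (S.integrable_rate_bound ρ i n).mono' (S.measurable_bestRate q i n).aestronglyMeasurable
    (ae_of_all _ fun ω => ?_)
  rw [Real.norm_of_nonneg (S.bestRate_nonneg hq i n ω)]
  exact S.bestRate_le hq i n ω

lemma bestSumRate_eq_sum {ρ : ℕ} [NeZero ρ] (q : Fin B → Fin N → ℝ) :
    (fun ω : Sample B N ρ => S.bestSumRate q ω) = fun ω => ∑ i, ∑ n, S.bestRate q i n ω :=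
  funext fun ω => S.bestSumRate_eq q ω

lemma integrable_bestSumRate {ρ : ℕ} [NeZero ρ] {q : Fin B → Fin N → ℝ} (hq : q ∈ S.powers) :
    Integrable (fun ω => S.bestSumRate q ω) (S.law ρ) := by
  rw [S.bestSumRate_eq_sum]
  exact integrable_finsetSum _ fun i _ => integrable_finsetSum _ fun n _ =>
    S.integrable_bestRate hq i n

lemma integral_bestSumRate {ρ : ℕ} [NeZero ρ] {q : Fin B → Fin N → ℝ} (hq : q ∈ S.powers) :
    ∫ ω, S.bestSumRate q ω ∂(S.law ρ) = ∑ i, ∑ n, ∫ ω, S.bestRate q i n ω ∂(S.law ρ) := by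
  rw [S.bestSumRate_eq_sum, integral_finsetSum _ fun i _ => integrable_finsetSum _ fun n _ =>
    S.integrable_bestRate hq i n]
  exact Finset.sum_congr rfl fun i _ =>
    integral_finsetSum _ fun n _ => S.integrable_bestRate hq i n

lemma continuousOn_bestRate {ρ : ℕ} [NeZero ρ] (i : Fin B) (n : Fin N) (ω : Sample B N ρ) :
    ContinuousOn (fun q => S.bestRate q i n ω) S.powers := by
  simp only [bestRate, ← Finset.sup'_univ_eq_ciSup]
  refine ContinuousOn.finset_sup'_apply _ fun k _ => ?_
  refine ContinuousOn.log ?_ fun q hq => ?_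
  · unfold userSinr
    refine continuousOn_const.add (ContinuousOn.mul (by fun_prop)
      (ContinuousOn.div continuousOn_const (by fun_prop) fun q hq => ?_))
    have := S.one_le_interference hq i n (cellData i n ω k)
    linarith
  · have := mul_nonneg (hq.1 i n) (S.userSinr_nonneg hq i n (cellData i n ω k))
    linarith

lemma isGreatest_expectedRates (ρ : ℕ) [NeZero ρ] :
    IsGreatest (S.expectedRates ρ) (S.CLB ρ) := by
  have himg : S.expectedRates ρ =
      (fun q => ∑ i, ∑ n, ∫ ω, S.bestRate q i n ω ∂(S.law ρ)) '' S.powers := by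
    ext v
    constructor
    · rintro ⟨q, hq, rfl⟩
      exact ⟨q, hq, (S.integral_bestSumRate hq).symm⟩
    · rintro ⟨q, hq, rfl⟩
      exact ⟨q, hq, (S.integral_bestSumRate hq).symm⟩
  have hcont : ContinuousOn (fun q => ∑ i, ∑ n, ∫ ω, S.bestRate q i n ω ∂(S.law ρ)) S.powers := by
    refine continuousOn_finsetSum _ fun i _ => continuousOn_finsetSum _ fun n _ => ?_
    refine continuousOn_of_dominated
      (fun q _ => (S.measurable_bestRate q i n).aestronglyMeasurable)
      (fun q hq => ae_of_all _ fun ω => ?_) (S.integrable_rate_bound ρ i n)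
      (ae_of_all _ fun ω => S.continuousOn_bestRate i n ω)
    rw [Real.norm_of_nonneg (S.bestRate_nonneg hq i n ω)]
    exact S.bestRate_le hq i n ω
  refine IsCompact.isGreatest_sSup ?_ ?_
  · rw [himg]
    exact S.isCompact_powers.image_of_continuousOn hcont
  · rw [himg]
    exact Set.Nonempty.image _ ⟨_, S.uniform_mem_powers⟩

/-- Beyond `t` the slope in `x` is at most `q / (1 + q * t) ≤ 1 / t`, whatever `q` is. This controls
both the mean excess and the cost of shifting a level. -/
lemma log_one_add_mul_le {q x t : ℝ} (hq : 0 ≤ q) (hx : 0 ≤ x) (ht : 0 < t) :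
    Real.log (1 + q * x) ≤ Real.log (1 + q * t) + t⁻¹ * max (x - t) 0 := by
  have hqx : 0 ≤ q * x := mul_nonneg hq hx
  have hqt : 0 ≤ q * t := mul_nonneg hq ht.le
  rcases le_total x t with h | h
  · rw [max_eq_right (by linarith), mul_zero, add_zero]
    exact Real.log_le_log (by linarith) (by gcongr)
  · rw [max_eq_left (by linarith)]
    have h1 : Real.log (1 + q * x) = Real.log (1 + q * t) +
        Real.log ((1 + q * x) / (1 + q * t)) := by
      rw [← Real.log_mul (by positivity) (by positivity), mul_div_cancel₀ _ (by positivity)]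
    rw [h1]
    gcongr
    refine (Real.log_le_sub_one_of_pos (by positivity)).trans ?_
    rw [div_sub_one (by positivity), div_le_iff₀ (by positivity)]
    have h2 : t⁻¹ * (x - t) * (1 + q * t) = t⁻¹ * (x - t) + (q * x - q * t) := by
      field_simp
    rw [h2]
    have : 0 ≤ t⁻¹ * (x - t) := mul_nonneg (by positivity) (by linarith)
    linarith

/-- Upper bounds for the expected rates by the excess over an arbitrary level. -/
lemma exists_integral_bestRate_le : ∃ M, 0 < M ∧ ∀ (ρ : ℕ) [NeZero ρ], ∀ q ∈ S.powers,
    ∀ i n t, 0 < t → ∫ ω, S.bestRate q i n ω ∂(S.law ρ) ≤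
      Real.log (1 + q i n * t) + ρ * S.peakGain / (t * S.levelCurve M q i n t) := by
  obtain ⟨M, hM, hle⟩ := S.exists_lintegral_userSinr_sub_le
  have ha := S.peakGain_pos
  refine ⟨M, hM, fun ρ _ q hq i n t ht => ?_⟩
  have hlc := S.levelCurve_pos hM hq i n ht.le
  have hX := S.measurable_userSinr q i n
  let E : Fin ρ → Sample B N ρ → ℝ := fun k ω =>
    max (S.userSinr q i n (cellData i n ω k) - t) 0
  have hmp : ∀ k, MeasurePreserving (fun ω : Sample B N ρ => cellData i n ω k) (S.law ρ)
      (S.userLaw i) := fun k =>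
    (measurePreserving_eval (fun _ : Fin ρ => S.userLaw i) k).comp
      ⟨measurable_cellData i n, S.map_cellData ρ i n⟩
  have hEm : ∀ k, Measurable (E k) := fun k =>
    ((hX.comp (hmp k).measurable).sub_const t).max measurable_const
  have hlint : ∀ k, ∫⁻ ω, ENNReal.ofReal (E k ω) ∂(S.law ρ) ≤
      ENNReal.ofReal (S.peakGain / S.levelCurve M q i n t) := fun k => by
    refine le_trans (le_of_eq ?_) (hle q hq i n t ht)
    rw [← (hmp k).lintegral_comp (f := fun y => ENNReal.ofReal (S.userSinr q i n y - t))
      (by fun_prop)]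
    refine lintegral_congr fun ω => ?_
    rcases le_total (S.userSinr q i n (cellData i n ω k) - t) 0 with h | h
    · simp [E, max_eq_right h, ENNReal.ofReal_of_nonpos h]
    · simp [E, max_eq_left h]
  have hEint : ∀ k, Integrable (E k) (S.law ρ) := fun k =>
    (lintegral_ofReal_ne_top_iff_integrable (hEm k).aestronglyMeasurable
      (ae_of_all _ fun ω => le_max_right _ _)).1 ((hlint k).trans_lt ENNReal.ofReal_lt_top).ne
  have hEle : ∀ k, ∫ ω, E k ω ∂(S.law ρ) ≤ S.peakGain / S.levelCurve M q i n t := fun k => by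
    have h0 : 0 ≤ᵐ[S.law ρ] E k := ae_of_all _ fun ω => le_max_right _ _
    rw [integral_eq_lintegral_of_nonneg_ae h0 (hEm k).aestronglyMeasurable]
    exact ENNReal.toReal_le_of_le_ofReal (by positivity) (hlint k)
  -- The largest excess is replaced by the sum of all excesses; at the relevant level this costs
  -- only a constant.
  have hpt : ∀ ω : Sample B N ρ, S.bestRate q i n ω ≤
      Real.log (1 + q i n * t) + t⁻¹ * ∑ k, E k ω := fun ω => by
    refine ciSup_le fun k => (log_one_add_mul_le (hq.1 i n)
      (S.userSinr_nonneg hq i n (cellData i n ω k)) ht).trans ?_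
    gcongr
    exact Finset.single_le_sum (f := fun k => E k ω) (fun k _ => le_max_right _ _)
      (Finset.mem_univ k)
  have hsum : Integrable (fun ω => t⁻¹ * ∑ k, E k ω) (S.law ρ) :=
    (integrable_finsetSum _ fun k _ => hEint k).const_mul _
  calc _ ≤ ∫ ω, (Real.log (1 + q i n * t) + t⁻¹ * ∑ k, E k ω) ∂(S.law ρ) :=
        integral_mono (S.integrable_bestRate hq i n) ((integrable_const _).add hsum) hpt
    _ = Real.log (1 + q i n * t) + t⁻¹ * ∑ k, ∫ ω, E k ω ∂(S.law ρ) := by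
        rw [integral_add (integrable_const _) hsum, integral_const_mul,
          integral_finsetSum _ fun k _ => hEint k]
        simp
    _ ≤ Real.log (1 + q i n * t) + t⁻¹ * ∑ k : Fin ρ, S.peakGain / S.levelCurve M q i n t := by
        gcongr with k
        exact hEle k
    _ = _ := by
        rw [Finset.sum_const, Finset.card_univ, Fintype.card_fin, nsmul_eq_mul]
        congr 1
        field_simp

/-- Lower bounds for the expected rates by the probability that some user exceeds a level. -/
lemma exists_le_integral_bestRate : ∃ c₀, 0 < c₀ ∧ ∀ (ρ : ℕ) [NeZero ρ], ∀ q ∈ S.powers,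
    ∀ i n t, 0 ≤ t → Real.log (1 + q i n * t) *
      (1 - Real.exp (-(ρ * (c₀ / S.levelCurve 1 q i n t)))) ≤
        ∫ ω, S.bestRate q i n ω ∂(S.law ρ) := by
  obtain ⟨c₀, hc₀, hle⟩ := S.exists_le_userLaw_userSinr
  refine ⟨c₀, hc₀, fun ρ _ q hq i n t ht => ?_⟩
  have hX := S.measurable_userSinr q i n
  have hmeas : MeasurableSet {y | t ≤ S.userSinr q i n y} := measurableSet_le measurable_const hX
  have hqt : 0 ≤ q i n * t := mul_nonneg (hq.1 i n) ht
  let A : Set (Sample B N ρ) := {ω | ∀ k, ¬ t ≤ S.userSinr q i n (cellData i n ω k)}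
  have hApre : A = cellData i n ⁻¹' (Set.univ.pi fun _ => {y | t ≤ S.userSinr q i n y}ᶜ) := by
    ext ω; simp [A]
  have hAm : MeasurableSet A := by
    rw [hApre]
    exact measurable_cellData i n (MeasurableSet.univ_pi fun _ => hmeas.compl)
  have hA : (S.law ρ).real A ≤ Real.exp (-(ρ * (c₀ / S.levelCurve 1 q i n t))) := by
    have h1 : (S.law ρ).real A = (1 - (S.userLaw i).real {y | t ≤ S.userSinr q i n y}) ^ ρ := by
      rw [← probReal_compl_eq_one_sub hmeas, measureReal_def, hApre,
        ← Measure.map_apply (measurable_cellData i n) (MeasurableSet.univ_pi fun _ => hmeas.compl),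
        S.map_cellData, Measure.pi_pi, Finset.prod_const, Finset.card_univ, Fintype.card_fin,
        ENNReal.toReal_pow, measureReal_def]
    rw [h1]
    have h2 : (S.userLaw i).real {y | t ≤ S.userSinr q i n y} ≤ 1 := measureReal_le_one
    calc _ ≤ (Real.exp (-(c₀ / S.levelCurve 1 q i n t))) ^ ρ := by
          refine pow_le_pow_left₀ (by linarith) ?_ ρ
          have h3 := Real.add_one_le_exp (-(c₀ / S.levelCurve 1 q i n t))
          have h4 := hle q hq i n t ht
          linarith
      _ = _ := by rw [← Real.exp_nat_mul]; congr 1; ring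
  have hpt : ∀ ω, Set.indicator Aᶜ (fun _ => Real.log (1 + q i n * t)) ω ≤
      S.bestRate q i n ω := fun ω => by
    by_cases hω : ω ∈ A
    · rw [Set.indicator_of_notMem (by simpa using hω)]
      exact S.bestRate_nonneg hq i n ω
    · rw [Set.indicator_of_mem hω]
      have : ∃ k, t ≤ S.userSinr q i n (cellData i n ω k) := by
        by_contra! h
        exact hω fun k => not_le.2 (h k)
      obtain ⟨k, hk⟩ := this
      refine le_trans ?_ (le_ciSup
        (f := fun k => Real.log (1 + q i n * S.userSinr q i n (cellData i n ω k)))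
        (Set.finite_range _).bddAbove k)
      have := hq.1 i n
      exact Real.log_le_log (by linarith) (by gcongr)
  calc _ ≤ Real.log (1 + q i n * t) * (1 - (S.law ρ).real A) := by
        have : 0 ≤ Real.log (1 + q i n * t) := Real.log_nonneg (by linarith)
        gcongr
    _ = ∫ ω, Set.indicator Aᶜ (fun _ => Real.log (1 + q i n * t)) ω ∂(S.law ρ) := by
        rw [integral_indicator_const _ hAm.compl, probReal_compl_eq_one_sub hAm, smul_eq_mul,
          mul_comm]
    _ ≤ _ := integral_mono ((integrable_const _).indicator hAm.compl)
        (S.integrable_bestRate hq i n) hpt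

end HexNetwork

/-! ### The asymptotic bounds. -/

namespace HexNetwork

variable {B N : ℕ} (S : HexNetwork B N)

/-- The optimal value of any of the problems `OP` bounds the expected rate up to a factor that
tends to one. -/
lemma eventually_CLB_le {p c₁ c₂ : ℝ} (hp : 0 < p) (hc₁ : 0 < c₁) (hc₂ : 0 < c₂) :
    ∀ᶠ ρ : ℕ in atTop, ∀ l, S.IsLbar p c₁ ρ l →
      S.CLB ρ ≤ (1 + S.peakGain * Real.eulerMascheroniConstant / l) * S.OP p c₂ ρ := by
  obtain ⟨M, hM, hle⟩ := S.exists_integral_bestRate_le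
  have ha := S.peakGain_pos
  have hr := S.r₀_pos
  have hM₂ := S.attenuation_pos hc₂
  have hu : 0 < Real.eulerMascheroniConstant :=
    (by norm_num : (0 : ℝ) < 1 / 2).trans Real.one_half_lt_eulerMascheroniConstant
  set a := S.peakGain
  set M₂ := S.attenuation c₂
  -- Bounds `ρ / levelCurve M q i n x` at the solution `x` of the constraint with attenuation `M₂`.
  set C : ℝ := (1 + M / M₂) ^ B * (p ^ 2 / S.r₀ ^ 2) with hC
  have hC0 : 0 < C := by positivity
  have hcast := tendsto_natCast_atTop_atTop (R := ℝ)
  have hH := (S.tendsto_normalized_atTop hp).comp hcast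
  filter_upwards [eventually_ge_atTop 1, hH.eventually_gt_atTop 1,
    hH.eventually (S.eventually_le_of_levelCurve hM₂ (θ := 1 / 2) (by norm_num)),
    -- Exactly what makes the `B * N` error terms `2 * a * C / l` sum to at most `a * u / l` times
    -- the optimal value.
    ((S.tendsto_OP_atTop hp hc₂).comp hcast).eventually_ge_atTop
      (2 * C * (B * N) / Real.eulerMascheroniConstant)] with ρ hρ h1 hx2 hOP l hl
  simp only [Function.comp_apply] at h1 hx2 hOP
  have : NeZero ρ := ⟨by omega⟩
  have hρ0 : (0 : ℝ) < ρ := by exact_mod_cast hρ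
  have hl0 := hl.1
  obtain ⟨q, hq, hqe⟩ := (S.isGreatest_expectedRates ρ).1
  obtain ⟨x, hx⟩ := S.exists_levelCurve_eq hM₂ h1.le hq
  have hlog : 0 < Real.log (S.r₀ ^ 2 * ρ / p ^ 2) := Real.log_pos h1
  have hV := (S.isGreatest_opValues hc₂ h1.le).2 (S.mem_opValues_iff.2 ⟨q, hq, x, hx, rfl⟩)
  have hterm : ∀ i n, ∫ ω, S.bestRate q i n ω ∂(S.law ρ) ≤
      Real.log (1 + q i n * x i n) + 2 * a * C / l := fun i n => by
    have h2 := hx2 q hq i n _ (hx i n).1 (hx i n).2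
    have hx0 : 0 < x i n := lt_of_lt_of_le (by positivity) h2
    refine (hle ρ q hq i n _ hx0).trans (add_le_add_right ?_ _)
    have hlc := S.levelCurve_pos hM hq i n hx0.le
    have h3 := S.levelCurve_le_mul hM hM₂ hq i n hx0.le
    rw [← (hx i n).2] at h3
    -- The distance `c₁` enters only here, through the bound `l ≤ a * log H`, which holds for every
    -- distance.
    have h4 : l ≤ 2 * x i n := by
      have := hl.le_mul_log S hc₁
      linarith
    have h5 : ρ ≤ C * S.levelCurve M q i n (x i n) := by
      rw [div_le_iff₀ (by positivity)] at h3
      rw [hC, mul_div_assoc', div_mul_eq_mul_div, le_div_iff₀ (by positivity)]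
      linarith
    rw [div_le_div_iff₀ (by positivity) hl0]
    calc ρ * a * l ≤ C * S.levelCurve M q i n (x i n) * a * (2 * x i n) := by gcongr
      _ = _ := by ring
  calc S.CLB ρ ≤ ∑ i, ∑ n, (Real.log (1 + q i n * x i n) + 2 * a * C / l) := by
        rw [hqe, S.integral_bestSumRate hq]
        exact Finset.sum_le_sum fun i _ => Finset.sum_le_sum fun n _ => hterm i n
    _ = ∑ i, ∑ n, Real.log (1 + q i n * x i n) +
          a * Real.eulerMascheroniConstant / l *
            (2 * C * (B * N) / Real.eulerMascheroniConstant) := by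
        simp only [Finset.sum_add_distrib, Finset.sum_const, Finset.card_univ, Fintype.card_fin,
          nsmul_eq_mul]
        congr 1
        field_simp
    _ ≤ S.OP p c₂ ρ + a * Real.eulerMascheroniConstant / l * S.OP p c₂ ρ := by gcongr
    _ = _ := by ring

lemma tendsto_log_log_atTop : Tendsto (fun ρ : ℕ => Real.log (Real.log ρ)) atTop atTop :=
  Real.tendsto_log_atTop.comp (Real.tendsto_log_atTop.comp tendsto_natCast_atTop_atTop)

/-- Division by `log (log ρ)` does not affect the order of the logarithm. -/
lemma eventually_log_div_log_log (C : ℝ) (hC : 0 < C) :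
    ∀ᶠ ρ : ℕ in atTop,
      0.95 * Real.log (C * ρ) ≤ Real.log (C * (ρ / Real.log (Real.log ρ))) ∧
      Real.log ρ / 2 ≤ Real.log (C * (ρ / Real.log (Real.log ρ))) := by
  have hlog : Tendsto (fun ρ : ℕ => Real.log ρ) atTop atTop :=
    Real.tendsto_log_atTop.comp tendsto_natCast_atTop_atTop
  have ho := Real.isLittleO_log_id_atTop.def (show (0 : ℝ) < 0.01 by norm_num)
  filter_upwards [hlog.eventually ho, tendsto_log_log_atTop.eventually_ge_atTop 1,
    hlog.eventually_ge_atTop (100 * |Real.log C| + 1), eventually_ge_atTop 1] with ρ h1 h2 h3 h4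
  have hρ : (0 : ℝ) < ρ := by exact_mod_cast h4
  have hL : 0 < Real.log ρ := by linarith [abs_nonneg (Real.log C)]
  rw [id, Real.norm_of_nonneg hL.le, Real.norm_of_nonneg (by linarith)] at h1
  have h5 : Real.log (Real.log (Real.log ρ)) ≤ Real.log (Real.log ρ) := by
    have := Real.log_le_sub_one_of_pos (show 0 < Real.log (Real.log ρ) by linarith)
    linarith
  have h6 := neg_abs_le (Real.log C)
  have h7 := le_abs_self (Real.log C)
  rw [Real.log_mul hC.ne' hρ.ne', Real.log_mul hC.ne' (by positivity),
    Real.log_div hρ.ne' (by linarith)]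
  constructor <;> norm_num at h1 ⊢ <;> linarith

lemma normalized_eq (p h : ℝ) : S.r₀ ^ 2 * h / p ^ 2 = S.r₀ ^ 2 / p ^ 2 * h := by ring

lemma tendsto_div_log_log :
    Tendsto (fun ρ : ℕ => (ρ : ℝ) / Real.log (Real.log ρ)) atTop atTop := by
  have h := tendsto_natCast_atTop_atTop (R := ℝ)
  have hlog : Tendsto (fun ρ : ℕ => Real.log ρ / 2) atTop atTop :=
    (Real.tendsto_log_atTop.comp h).atTop_div_const (by norm_num)
  have h1 : Tendsto (fun ρ : ℕ => Real.exp (Real.log (1 * ((ρ : ℝ) / Real.log (Real.log ρ)))))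
      atTop atTop := by
    refine Real.tendsto_exp_atTop.comp (tendsto_atTop_mono' _ ?_ hlog)
    filter_upwards [eventually_log_div_log_log 1 one_pos] with ρ hρ using hρ.2
  refine h1.congr' ?_
  filter_upwards [tendsto_log_log_atTop.eventually_gt_atTop 0, eventually_ge_atTop 1] with ρ h2 h3
  have hρ : (0 : ℝ) < ρ := by exact_mod_cast h3
  rw [one_mul, Real.exp_log (by positivity)]

/-- The expected rate is bounded from below by the value of the problem with interferers at
distance `r₀`. -/
lemma eventually_le_CLB {p : ℝ} (hp : 0 < p) :
    ∀ᶠ ρ : ℕ in atTop,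
      (1 - 1 / Real.log ρ) * S.OP p S.r₀ (ρ / Real.log (Real.log ρ)) ≤ S.CLB ρ := by
  obtain ⟨c₀, hc₀, hle⟩ := S.exists_le_integral_bestRate
  have ha := S.peakGain_pos
  have hr := S.r₀_pos
  set a := S.peakGain with hadef
  -- After the level is lowered by `a * K`, the expected number of users above it is at least `2 *
  -- log (log ρ)`; one factor `log (log ρ)` comes from the reduced `h`.
  obtain ⟨K, hK0, hK⟩ : ∃ K : ℝ, 0 ≤ K ∧ 2 ≤ c₀ * (p ^ 2 / S.r₀ ^ 2) * Real.exp K := by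
    have h := Real.tendsto_exp_atTop.const_mul_atTop (show 0 < c₀ * (p ^ 2 / S.r₀ ^ 2) by positivity)
    exact ((eventually_ge_atTop 0).and (h.eventually_ge_atTop 2)).exists
  have hlog : Tendsto (fun ρ : ℕ => Real.log ρ) atTop atTop :=
    Real.tendsto_log_atTop.comp tendsto_natCast_atTop_atTop
  have hH := (S.tendsto_normalized_atTop hp).comp tendsto_div_log_log
  filter_upwards [eventually_ge_atTop 1, hH.eventually_ge_atTop 1,
    hH.eventually (S.eventually_le_of_levelCurve one_pos (θ := 1 / 2) (by norm_num)),
    hlog.eventually_ge_atTop (8 * K + 2), tendsto_log_log_atTop.eventually_gt_atTop 0,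
    eventually_log_div_log_log (S.r₀ ^ 2 / p ^ 2) (by positivity),
    ((S.tendsto_OP_atTop hp hr).comp tendsto_div_log_log).eventually_ge_atTop
      (16 * K * (B * N))] with ρ hρ h1 hx2 hL hLL hHL hOP
  simp only [Function.comp_apply] at h1 hx2 hOP
  have : NeZero ρ := ⟨by omega⟩
  have hρ0 : (0 : ℝ) < ρ := by exact_mod_cast hρ
  set L := Real.log ρ with hLdef
  set h := ρ / Real.log L with hh
  set H := S.r₀ ^ 2 * h / p ^ 2 with hHdef
  rw [← normalized_eq, ← normalized_eq] at hHL
  have hL2 : 2 ≤ L := by linarith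
  have hL0 : 0 < L := by linarith
  obtain ⟨q, hq, x, hx, hv⟩ := S.mem_opValues_iff.1 (S.isGreatest_opValues hr h1).1
  rw [attenuation_r₀] at hx
  have hCLB : ∑ i, ∑ n, ∫ ω, S.bestRate q i n ω ∂(S.law ρ) ≤ S.CLB ρ :=
    (S.isGreatest_expectedRates ρ).2 ⟨q, hq, (S.integral_bestSumRate hq).symm⟩
  have hfac : 0 ≤ 1 - 1 / L ^ 2 := by
    rw [sub_nonneg, div_le_one (by positivity)]
    nlinarith
  have hterm : ∀ i n, (1 - 1 / L ^ 2) * (Real.log (1 + q i n * x i n) - 8 * K / L) ≤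
      ∫ ω, S.bestRate q i n ω ∂(S.law ρ) := fun i n => by
    have h2 := hx2 q hq i n _ (hx i n).1 (hx i n).2
    have h3 : a * (L / 4) ≤ x i n := by
      have := mul_le_mul_of_nonneg_left hHL.2 ha.le
      linarith
    have h3' : a * (8 * K + 2) ≤ a * L := by gcongr
    have h3'' : 0 ≤ a * K := by positivity
    -- As `x ≥ a * L / 4` and `8 * K ≤ L`, the shifted level is still at least `a * L / 8`, so the
    -- shift costs at most `8 * K / L` in the rate.
    set t := x i n - a * K with ht
    have h4 : a * (L / 8) ≤ t := by linarith
    have ht0 : 0 < t := lt_of_lt_of_le (by positivity) h4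
    have h5 : Real.log (1 + q i n * x i n) ≤ Real.log (1 + q i n * t) + 8 * K / L := by
      refine (log_one_add_mul_le (hq.1 i n) (hx i n).1 ht0).trans ?_
      gcongr
      have h6 : x i n - t = a * K := by rw [ht]; ring
      rw [h6, max_eq_left h3'', inv_mul_eq_div, div_le_div_iff₀ ht0 hL0]
      calc a * K * L = 8 * K * (a * (L / 8)) := by ring
        _ ≤ _ := by gcongr
    have h7 : S.levelCurve 1 q i n t ≤ Real.exp (-K) * H := by
      rw [hHdef, (hx i n).2]
      exact S.levelCurve_sub_le one_pos hq i n hK0 (by linarith)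
    have hlc := S.levelCurve_pos one_pos hq i n ht0.le
    have h8 : 2 * Real.log L ≤ ρ * (c₀ / S.levelCurve 1 q i n t) := by
      rw [mul_div_assoc', le_div_iff₀ hlc]
      calc 2 * Real.log L * S.levelCurve 1 q i n t
          ≤ 2 * Real.log L * (Real.exp (-K) * H) := by gcongr
        _ ≤ (c₀ * (p ^ 2 / S.r₀ ^ 2) * Real.exp K) * Real.log L * (Real.exp (-K) * H) := by
            have : 0 < H := by linarith
            gcongr
        _ = ρ * c₀ := by
            rw [Real.exp_neg, hHdef, hh]
            field_simp
    have h9 : Real.exp (-(ρ * (c₀ / S.levelCurve 1 q i n t))) ≤ 1 / L ^ 2 := by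
      have : 1 / L ^ 2 = Real.exp (-(2 * Real.log L)) := by
        rw [Real.exp_neg, mul_comm, Real.exp_mul, Real.exp_log hL0, one_div, Real.rpow_ofNat]
      rw [this]
      exact Real.exp_le_exp.2 (by linarith)
    have h10 : 0 ≤ Real.log (1 + q i n * t) :=
      Real.log_nonneg (le_add_of_nonneg_right (mul_nonneg (hq.1 i n) ht0.le))
    calc _ ≤ (1 - 1 / L ^ 2) * Real.log (1 + q i n * t) := by
          gcongr
          linarith
      _ ≤ Real.log (1 + q i n * t) * (1 - Real.exp (-(ρ * (c₀ / S.levelCurve 1 q i n t)))) := by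
          rw [mul_comm]
          gcongr
      _ ≤ _ := hle ρ q hq i n t ht0.le
  have hsum : (1 - 1 / L ^ 2) * (S.OP p S.r₀ h - B * N * (8 * K / L)) ≤ S.CLB ρ := by
    refine le_trans (le_of_eq ?_) ((Finset.sum_le_sum fun i _ =>
      Finset.sum_le_sum fun n _ => hterm i n).trans hCLB)
    simp only [← Finset.mul_sum, Finset.sum_sub_distrib, Finset.sum_const, Finset.card_univ,
      Fintype.card_fin, nsmul_eq_mul]
    rw [hv]
    ring
  refine le_trans ?_ hsum
  have hBN : (0 : ℝ) ≤ B * N := by positivity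
  set V := S.OP p S.r₀ h
  have hV0 : 0 ≤ V := le_trans (by positivity) hOP
  have hLinv : 0 < L⁻¹ := by positivity
  have hLinv2 : L⁻¹ ≤ 1 / 2 := by
    rw [inv_le_comm₀ hL0 (by norm_num)]; norm_num; exact hL2
  -- The slack `1 / L - 1 / L ^ 2` must cover the loss `8 * K * B * N / L`; with `L ≥ 2` it is at
  -- least `1 / (2 * L)`, so `V ≥ 16 * K * B * N` suffices.
  have e1 : (1 - 1 / L ^ 2) * (V - B * N * (8 * K / L)) - (1 - 1 / L) * V =
      L⁻¹ * ((1 - L⁻¹) * V - (1 - L⁻¹ ^ 2) * (8 * K * (B * N))) := by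
    field_simp
    ring
  have e2 : 0 ≤ 8 * K * (B * N) := by positivity
  have e3 : 0 ≤ (1 - L⁻¹) * V - (1 - L⁻¹ ^ 2) * (8 * K * (B * N)) := by
    nlinarith [mul_nonneg (show 0 ≤ 1 / 2 - L⁻¹ by linarith) hV0, mul_nonneg (sq_nonneg L⁻¹) e2]
  have := mul_nonneg hLinv.le e3
  linarith

/-- The optimal value depends on the number of users only to lower order. -/
lemma eventually_mul_OP_le_OP_div {p : ℝ} (hp : 0 < p) :
    ∀ᶠ ρ : ℕ in atTop,
      0.9 * S.OP p S.r₀ ρ ≤ S.OP p S.r₀ (ρ / Real.log (Real.log ρ)) := by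
  have ha := S.peakGain_pos
  have hr := S.r₀_pos
  have hM := S.attenuation_pos hr
  have hH := (S.tendsto_normalized_atTop hp).comp tendsto_div_log_log
  have hH' := (S.tendsto_normalized_atTop hp).comp (tendsto_natCast_atTop_atTop (R := ℝ))
  filter_upwards [hH.eventually_ge_atTop 1, hH'.eventually_ge_atTop 1,
    hH.eventually (S.eventually_le_of_levelCurve hM (θ := 0.95) (by norm_num)),
    eventually_log_div_log_log (S.r₀ ^ 2 / p ^ 2) (by positivity)] with ρ h1 h1' hy hHL
  simp only [Function.comp_apply] at h1 h1' hy
  rw [← normalized_eq, ← normalized_eq] at hHL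
  obtain ⟨q, hq, x, hx, hv⟩ := S.mem_opValues_iff.1 (S.isGreatest_opValues hr h1').1
  obtain ⟨y, hye⟩ := S.exists_levelCurve_eq hM h1 hq
  rw [hv, Finset.mul_sum]
  refine le_trans ?_ ((S.isGreatest_opValues hr h1).2 (S.mem_opValues_iff.2 ⟨q, hq, y, hye, rfl⟩))
  refine Finset.sum_le_sum fun i _ => ?_
  rw [Finset.mul_sum]
  refine Finset.sum_le_sum fun n _ => ?_
  have hx0 := (hx i n).1
  have hq0 := hq.1 i n
  have h2 := hy q hq i n _ (hye i n).1 (hye i n).2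
  have h3 := S.le_mul_log_of_levelCurve hM hq i n hx0 (hx i n).2
  have h4 := mul_le_mul_of_nonneg_left hHL.1 ha.le
  -- One factor 0.95 comes from the solution `y`, the other from the logarithm of the reduced `h`;
  -- their product exceeds 0.9.
  have h5 : 0.9 * x i n ≤ y i n := by
    norm_num at h2 h4 ⊢
    linarith
  have h6 : 0 ≤ q i n * x i n := mul_nonneg hq0 hx0
  -- Bernoulli: `(1 + s) ^ 0.9 ≤ 1 + 0.9 * s` carries the factor 0.9 through the logarithm.
  have h7 := rpow_one_add_le_one_add_mul_self (s := q i n * x i n) (by linarith)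
    (show (0 : ℝ) ≤ 0.9 by norm_num) (by norm_num)
  rw [← Real.log_rpow (by linarith)]
  refine Real.log_le_log (by positivity) (h7.trans ?_)
  have := mul_le_mul_of_nonneg_left h5 hq0
  linarith

lemma eventually_mul_OP_le_CLB {p : ℝ} (hp : 0 < p) :
    ∀ᶠ ρ : ℕ in atTop, 0.63 * S.OP p S.r₀ ρ ≤ S.CLB ρ := by
  have hlog : Tendsto (fun ρ : ℕ => Real.log ρ) atTop atTop :=
    Real.tendsto_log_atTop.comp tendsto_natCast_atTop_atTop
  filter_upwards [S.eventually_le_CLB hp, S.eventually_mul_OP_le_OP_div hp,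
    hlog.eventually_ge_atTop 10, ((S.tendsto_OP_atTop hp S.r₀_pos).comp
      (tendsto_natCast_atTop_atTop (R := ℝ))).eventually_ge_atTop 0] with ρ h1 h2 h3 h4
  refine le_trans ?_ h1
  simp only [Function.comp_apply] at h4
  have h5 : 1 / Real.log ρ ≤ 1 / 10 := one_div_le_one_div_of_le (by norm_num) h3
  -- One 0.9 stands for `1 - 1 / log ρ`, the other for the passage to `ρ / log log ρ`; since 0.81
  -- exceeds 0.63 there is room to spare.
  calc 0.63 * S.OP p S.r₀ ρ ≤ 0.9 * (0.9 * S.OP p S.r₀ ρ) := by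
        norm_num
        linarith
    _ ≤ _ := mul_le_mul (by linarith) h2 (by positivity) (by linarith)

end HexNetwork

theorem corollary2 {B N : ℕ} (S : HexNetwork B N) (p : ℝ) (hp : 0 < p) :
    ∀ᶠ ρ : ℕ in atTop,
      -- the expectations exist, the maxima are attained and `l̄` is uniquely determined
      (∀ q ∈ S.powers, Integrable (fun ω => S.bestSumRate q ω) (S.law ρ)) ∧
      IsGreatest (S.expectedRates ρ) (S.CLB ρ) ∧
      IsGreatest (S.opValues p S.r₀ ((ρ : ℝ) / Real.log (Real.log ρ)))
        (S.OP p S.r₀ ((ρ : ℝ) / Real.log (Real.log ρ))) ∧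
      IsGreatest (S.opValues p S.r₀ ρ) (S.OP p S.r₀ ρ) ∧
      IsGreatest (S.opValues p (S.R * Real.sqrt 3 / 2) ρ) (S.OP p (S.R * Real.sqrt 3 / 2) ρ) ∧
      (∃! l : ℝ, S.IsLbar p (S.R * Real.sqrt 3 / 2) ρ l) ∧
      -- the bounds
      ∀ l : ℝ, S.IsLbar p (S.R * Real.sqrt 3 / 2) ρ l →
        (1 - 1 / Real.log ρ) * S.OP p S.r₀ ((ρ : ℝ) / Real.log (Real.log ρ)) ≤ S.CLB ρ ∧
        S.CLB ρ ≤ (1 + S.β ^ 2 * S.r₀ ^ (-2 * S.α) * Real.eulerMascheroniConstant / l) *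
          S.OP p (S.R * Real.sqrt 3 / 2) ρ ∧
        0.63 * S.OP p S.r₀ ρ ≤ S.CLB ρ ∧
        (S.r₀ ≤ S.R * Real.sqrt 3 / 2 →
          S.CLB ρ ≤ (1 + S.β ^ 2 * S.r₀ ^ (-2 * S.α) * Real.eulerMascheroniConstant / l) *
            (S.R * Real.sqrt 3 / (2 * S.r₀)) ^ (2 * S.α) * S.OP p S.r₀ ρ) := by
  have hr := S.r₀_pos
  have hR := S.R_pos
  have hα := S.one_lt_α
  have hc : 0 < S.R * Real.sqrt 3 / 2 := by positivity
  have hcast := tendsto_natCast_atTop_atTop (R := ℝ)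
  have hH := (S.tendsto_normalized_atTop hp).comp hcast
  have hH' := (S.tendsto_normalized_atTop hp).comp HexNetwork.tendsto_div_log_log
  filter_upwards [eventually_ge_atTop 1, hH.eventually_gt_atTop 1, hH'.eventually_ge_atTop 1,
    S.eventually_le_CLB hp, S.eventually_CLB_le hp hc hc, S.eventually_mul_OP_le_CLB hp,
    S.eventually_CLB_le hp hc hr, ((S.tendsto_OP_atTop hp hr).comp hcast).eventually_ge_atTop 0]
    with ρ hρ h1 h1' hlower hupper hconst hupper' hOP
  have : NeZero ρ := ⟨by omega⟩
  refine ⟨fun q hq => S.integrable_bestSumRate hq, S.isGreatest_expectedRates ρ,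
    S.isGreatest_opValues hr h1', S.isGreatest_opValues hr (le_of_lt h1),
    S.isGreatest_opValues hc (le_of_lt h1), S.existsUnique_isLbar hc h1, fun l hl => ?_⟩
  -- The upper bound with interferers at distance `r₀` holds already without the factor `(R√3 / (2 *
  -- r₀)) ^ (2 * α)`, which is at least one when `r₀ ≤ R√3 / 2`.
  refine ⟨hlower, hupper l hl, hconst, fun hle => (hupper' l hl).trans ?_⟩
  refine mul_le_mul_of_nonneg_right ?_ hOP
  have hu : 0 < Real.eulerMascheroniConstant :=
    (by norm_num : (0 : ℝ) < 1 / 2).trans Real.one_half_lt_eulerMascheroniConstant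
  have hpos : 0 ≤ 1 + S.peakGain * Real.eulerMascheroniConstant / l := by
    have := S.peakGain_pos
    have := hl.1
    positivity
  refine le_mul_of_one_le_right hpos (Real.one_le_rpow ?_ (by linarith))
  rw [le_div_iff₀ (by positivity)]
  linarith
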